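/- Let $d\ge 1$, $m\ge 1$, let $\Omega\subset\mathbb R^d$ be a bounded open set (for instance a bounded Lipschitz domain), and let $\nu>0$, $T>0$. Write $L^2=L^2(\Omega;\mathbb R^m)$ ($m=1$ is the scalar case) and $H^1_0=H^1_0(\Omega;\mathbb R^m)$, the closure of $C_c^\infty(\Omega;\mathbb R^m)$ in $H^1$, with inner product $(v,w)_{H^1_0}=(\nabla v,\nabla w)_{L^2}$. **Heat equation.** Let $f\in C([0,T];L^2)$, and let $u\in C([0,T];L^2)$ with $u(t)\in H^1_0$ for all $t\in[0,T]$ and $u_t\in L^2(0,T;L^2)$ be a weak solution of $u_t-\nu\Delta u=f$ with homogeneous Dirichlet boundary conditions: $(u_t,v)_{L^2}+\nu(\nabla u,\nabla v)_{L^2}=(f,v)_{L^2}$ for all $v\in H^1_0$ and almost every $t\in(0,T)$. Assume that $u_{ttt},\ \Delta u_{tt},\ f_{tt}\in L^2(0,T;L^2)$ (weak derivatives), and put $$I(u,f)=\|u_{ttt}\|_{L^2(0,T;L^2)}^2+\|\Delta u_{tt}\|_{L^2(0,T;L^2)}^2+\|f_{tt}\|_{L^2(0,T;L^2)}^2 .$$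 **POD with difference quotients.** For $N\ge1$ let $\Delta t=T/N$, $t_n=n\Delta t$, $u^n=u(t_n)$, $f^n=f(t_n)$. Take the $2N+1$ snapshots $v^n=u^n$ $(0\le n\le N)$ and $v^{N+n}=(u^n-u^{n-1})/\Delta t$ $(1\le n\le N)$. Let $\mathcal H$ be $L^2$ or $H^1_0$, let $\lambda_1^{DQ}\ge\dots\ge\lambda_{2N+1}^{DQ}\ge0$ be the eigenvalues and $\mathbf z_i$ corresponding orthonormal eigenvectors of the matrix $K_{ij}=\frac1{2N+1}(v^i,v^j)_{\mathcal H}$, $0\le i,j\le 2N$, and let $s$ be the number of positive eigenvalues. The POD modes are $\varphi_i=(\lambda_i^{DQ})^{-1/2}(2N+1)^{-1/2}\sum_{k=0}^{2N}(\mathbf z_i)^k v^k$, $1\le i\le s$; they form the $L^2$ POD basis if $\mathcal H=L^2$ and the $H^1_0$ POD basis if $\mathcal H=H^1_0$. For $0\le r\le s$ let $X^r=\mathrm{span}\{\varphi_1,\dots,\varphi_r\}$, and let $R_r:H^1_0\to X^r$ be the Ritz projection, defined by $(\nabla(w-R_rw),\nabla v_r)_{L^2}=0$ for all $v_r\in X^r$.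 **Reduced order model.** Let $u_r^0,\dots,u_r^N\in X^r$ satisfy the Crank–Nicolson Galerkin scheme $$\Big(\frac{u_r^{n+1}-u_r^n}{\Delta t},v_r\Big)_{L^2}+\nu\Big(\nabla\frac{u_r^{n+1}+u_r^n}2,\nabla v_r\Big)_{L^2}=\Big(\frac{f^{n+1}+f^n}2,v_r\Big)_{L^2}\qquad\forall v_r\in X^r,\ 0\le n<N,$$ with arbitrary initial value $u_r^0\in X^r$. Put $e^k=u^k-u_r^k$ and $\phi_r^0=u_r^0-R_ru^0$. **Claim.** There is a constant $C>0$, depending only on $d,m,\Omega,\nu,T$ (in particular independent of $N$, $\Delta t$, $r$, $s$, of the POD eigenvalues and modes, and of $u$, $f$ and $u_r^0$), such that in all these situations the following holds. If the $L^2$ POD basis is used, then $$\max_{1\le k\le N}\|\nabla e^k\|_{L^2}^2\le C\Big(\sum_{i=r+1}^s\lambda_i^{DQ}\big(\|\varphi_i-R_r\varphi_i\|_{L^2}^2+\|\nabla(\varphi_i-R_r\varphi_i)\|_{L^2}^2\big)+\|\nabla\phi_r^0\|_{L^2}^2+\Delta t^4 I(u,f)\Big),$$ and if the $H^1_0$ POD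 basis is used, then $$\max_{1\le k\le N}\|\nabla e^k\|_{L^2}^2\le C\Big(\sum_{i=r+1}^s\lambda_i^{DQ}\big(1+\|\varphi_i\|_{L^2}^2\big)+\|\nabla\phi_r^0\|_{L^2}^2+\Delta t^4 I(u,f)\Big).$$ -/

import Mathlib

open MeasureTheory Set
open scoped ContDiff

noncomputable section

namespace HeatROM

/-! ### Function spaces -/

/-- `L²(Ω; ℝᵐ)` for `Ω ⊆ ℝᵈ` (the scalar case is `m = 1`). -/
abbrev L2 (d m : ℕ) (Ω : Set (EuclideanSpace ℝ (Fin d))) : Type :=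
  Lp (EuclideanSpace ℝ (Fin m)) 2 (volume.restrict Ω)

/-- Square integrable gradients, i.e. families `(∂₁v, …, ∂_d v)` in `L²(Ω; ℝᵐ)`, with the inner
product `∑ᵢ (∂ᵢv, ∂ᵢw)_{L²}`. -/
abbrev GradL2 (d m : ℕ) (Ω : Set (EuclideanSpace ℝ (Fin d))) : Type :=
  PiLp 2 (fun _ : Fin d => L2 d m Ω)

/-- `φ ∈ C_c^∞(Ω; ℝᵐ)`. -/
structure IsTestFunction {d m : ℕ} (Ω : Set (EuclideanSpace ℝ (Fin d)))
    (φ : EuclideanSpace ℝ (Fin d) → EuclideanSpace ℝ (Fin m)) : Prop where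
  smooth : ContDiff ℝ ∞ φ
  compactSupport : HasCompactSupport φ
  tsupport_subset : tsupport φ ⊆ Ω

/-- `H¹₀(Ω; ℝᵐ)`: the closure in `H¹` of the test functions. A function `v` is represented by the
pair `(v, ∇v)`, whose second component is its (unique) weak gradient; the topology of the product
`L² × (L²)ᵈ` is the one of the `H¹` norm. -/
def H10 (d m : ℕ) (Ω : Set (EuclideanSpace ℝ (Fin d))) :
    Submodule ℝ (L2 d m Ω × GradL2 d m Ω) :=
  (Submodule.span ℝ {p | ∃ φ : EuclideanSpace ℝ (Fin d) → EuclideanSpace ℝ (Fin m),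
    IsTestFunction Ω φ ∧ (p.1 : EuclideanSpace ℝ (Fin d) → _) =ᵐ[volume.restrict Ω] φ ∧
      ∀ i, (p.2 i : EuclideanSpace ℝ (Fin d) → _) =ᵐ[volume.restrict Ω]
        fun x => fderiv ℝ φ x (EuclideanSpace.single i 1)}).topologicalClosure

variable {d m : ℕ} {Ω : Set (EuclideanSpace ℝ (Fin d))}

/-- The inclusion `H¹₀ → L²`. -/
def toL2 : H10 d m Ω →ₗ[ℝ] L2 d m Ω := LinearMap.fst ℝ _ _ ∘ₗ (H10 d m Ω).subtype

/-- The gradient `∇ : H¹₀ → (L²)ᵈ`. -/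
def grad : H10 d m Ω →ₗ[ℝ] GradL2 d m Ω := LinearMap.snd ℝ _ _ ∘ₗ (H10 d m Ω).subtype

/-- The inner product `(v, w)_{L²}`. -/
def innerL2 (v w : H10 d m Ω) : ℝ := inner ℝ (toL2 v) (toL2 w)

/-- The inner product `(v, w)_{H¹₀} = (∇v, ∇w)_{L²}`. -/
def innerH10 (v w : H10 d m Ω) : ℝ := inner ℝ (grad v) (grad w)

/-- `g ∈ L²` is the distributional Laplacian of `w ∈ L²`. -/
def IsWeakLaplacian (w g : L2 d m Ω) : Prop :=
  ∀ φ : EuclideanSpace ℝ (Fin d) → EuclideanSpace ℝ (Fin m), IsTestFunction Ω φ →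
    ∫ x in Ω, inner ℝ (w x) (Laplacian.laplacian φ x) = ∫ x in Ω, inner ℝ (g x) (φ x)

/-- `g` is the weak (distributional) `k`-th derivative of `z` on the time interval `(0, T)`. -/
def IsWeakTimeDeriv {Z : Type*} [NormedAddCommGroup Z] [NormedSpace ℝ Z]
    (T : ℝ) (k : ℕ) (z g : ℝ → Z) : Prop :=
  ∀ ψ : ℝ → ℝ, ContDiff ℝ ∞ ψ → HasCompactSupport ψ → tsupport ψ ⊆ Ioo 0 T →
    ∫ t in Ioo 0 T, iteratedDeriv k ψ t • z t = (-1 : ℝ) ^ k • ∫ t in Ioo 0 T, ψ t • g t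

/-- `g ∈ L²(0, T; Z)`. -/
def MemL2Time {Z : Type*} [NormedAddCommGroup Z] (T : ℝ) (g : ℝ → Z) : Prop :=
  MemLp g 2 (volume.restrict (Ioo 0 T))

/-- `‖g‖²_{L²(0,T;Z)}`. -/
def sqNormL2Time {Z : Type*} [NormedAddCommGroup Z] (T : ℝ) (g : ℝ → Z) : ℝ :=
  ∫ t in Ioo 0 T, ‖g t‖ ^ 2

/-! ### The heat equation -/

/-- `u`, with `u(t) ∈ H¹₀` for every `t ∈ [0, T]`, is a weak solution of `u_t - ν Δu = f` with
homogeneous Dirichlet boundary conditions. The initial value is `u 0`. -/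
structure IsHeatSolution (ν T : ℝ) (u : ℝ → H10 d m Ω) (f : ℝ → L2 d m Ω) : Prop where
  continuousOn_u : ContinuousOn (fun t => toL2 (u t)) (Icc 0 T)
  continuousOn_f : ContinuousOn f (Icc 0 T)
  weak_form : ∃ ut : ℝ → L2 d m Ω, MemL2Time T ut ∧
    IsWeakTimeDeriv T 1 (fun t => toL2 (u t)) ut ∧
    ∀ᵐ t ∂(volume.restrict (Ioo 0 T)), ∀ v : H10 d m Ω,
      inner ℝ (ut t) (toL2 v) + ν * inner ℝ (grad (u t)) (grad v) = inner ℝ (f t) (toL2 v)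

/-- The regularity condition `u_ttt, Δu_tt, f_tt ∈ L²(0, T; L²)`; the last three arguments are
these derivatives. -/
structure HasRegularity (T : ℝ) (u : ℝ → H10 d m Ω) (f uttt Δutt ftt : ℝ → L2 d m Ω) : Prop where
  memL2_uttt : MemL2Time T uttt
  memL2_lap_utt : MemL2Time T Δutt
  memL2_ftt : MemL2Time T ftt
  deriv_uttt : IsWeakTimeDeriv T 3 (fun t => toL2 (u t)) uttt
  deriv_lap_utt : ∃ utt : ℝ → L2 d m Ω, MemL2Time T utt ∧
    IsWeakTimeDeriv T 2 (fun t => toL2 (u t)) utt ∧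
    ∀ᵐ t ∂(volume.restrict (Ioo 0 T)), IsWeakLaplacian (utt t) (Δutt t)
  deriv_ftt : IsWeakTimeDeriv T 2 f ftt

/-- `I(u, f) = ‖u_ttt‖² + ‖Δu_tt‖² + ‖f_tt‖²`, norms in `L²(0, T; L²)`. -/
def regConst (T : ℝ) (uttt Δutt ftt : ℝ → L2 d m Ω) : ℝ :=
  sqNormL2Time T uttt + sqNormL2Time T Δutt + sqNormL2Time T ftt

/-! ### POD with difference quotients -/

/-- The time `t_n = n Δt`, with `Δt = T / N`. -/
def time (T : ℝ) (N n : ℕ) : ℝ := (n : ℝ) * (T / (N : ℝ))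

/-- The snapshots `v^n = u(t_n)` for `0 ≤ n ≤ N` and
`v^{N+n} = (u(t_n) - u(t_{n-1})) / Δt` for `1 ≤ n ≤ N`. -/
def dqSnapshots {E : Type*} [AddCommGroup E] [Module ℝ E] (T : ℝ) (N : ℕ) (u : ℝ → E)
    (j : Fin (2 * N + 1)) : E :=
  if j.val ≤ N then u (time T N j.val)
  else (T / N)⁻¹ • (u (time T N (j.val - N)) - u (time T N (j.val - N - 1)))

/-- The snapshot correlation matrix `K_{ij} = M⁻¹ (vⁱ, vʲ)` of `M` snapshots, for the inner product
`ip` of the POD Hilbert space. -/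
def corrMatrix {E : Type*} {M : ℕ} (ip : E → E → ℝ) (v : Fin M → E) :
    Matrix (Fin M) (Fin M) ℝ :=
  Matrix.of fun i j => (M : ℝ)⁻¹ * ip (v i) (v j)

/-- `lam` lists the POD eigenvalues in decreasing order, and `z` is a corresponding orthonormal
system of eigenvectors of the snapshot correlation matrix. Indices start at `0`. -/
structure IsPOD {E : Type*} {M : ℕ} (ip : E → E → ℝ) (v : Fin M → E) (lam : Fin M → ℝ)
    (z : Fin M → EuclideanSpace ℝ (Fin M)) : Prop where
  antitone : Antitone lam
  orthonormal : Orthonormal ℝ z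
  eigen : ∀ i, Matrix.mulVec (corrMatrix ip v) (z i) = lam i • ⇑(z i)

/-- The number `s` of positive POD eigenvalues. -/
def podRank {M : ℕ} (lam : Fin M → ℝ) : ℕ :=
  (Finset.univ.filter fun i => 0 < lam i).card

/-- The POD mode `φ_i = λ_i^{-1/2} M^{-1/2} ∑_k (z_i)^k v^k`, meaningful when `λ_i > 0`. -/
def podMode {E : Type*} [AddCommGroup E] [Module ℝ E] {M : ℕ} (v : Fin M → E) (lam : Fin M → ℝ)
    (z : Fin M → EuclideanSpace ℝ (Fin M)) (i : Fin M) : E :=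
  ((√(lam i))⁻¹ * (√(M : ℝ))⁻¹) • ∑ k, z i k • v k

/-- `X^r`, the span of the first `r` POD modes. -/
def podSpace {E : Type*} [AddCommGroup E] [Module ℝ E] {M : ℕ} (v : Fin M → E) (lam : Fin M → ℝ)
    (z : Fin M → EuclideanSpace ℝ (Fin M)) (r : ℕ) : Submodule ℝ E :=
  Submodule.span ℝ (podMode v lam z '' {i | (i : ℕ) < r})

instance {E : Type*} [AddCommGroup E] [Module ℝ E] {M : ℕ} (v : Fin M → E) (lam : Fin M → ℝ)
    (z : Fin M → EuclideanSpace ℝ (Fin M)) (r : ℕ) :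
    FiniteDimensional ℝ (podSpace v lam z r) :=
  FiniteDimensional.span_of_finite ℝ (Set.toFinite _)

/-- The truncation index set `{i : r < i ≤ s}` (one-based), that is `r ≤ i < s` with indices
starting at `0`. -/
def truncated {M : ℕ} (lam : Fin M → ℝ) (r : ℕ) : Finset (Fin M) :=
  Finset.univ.filter fun i => r ≤ (i : ℕ) ∧ (i : ℕ) < podRank lam

/-! ### Ritz projection and reduced order model -/

theorem exists_ritz (V : Submodule ℝ (H10 d m Ω)) [FiniteDimensional ℝ V] (w : H10 d m Ω) :
    ∃ p ∈ V, ∀ v ∈ V, innerH10 (w - p) v = 0 := by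
  have hp := (V.map grad).starProjection_apply_mem (grad w)
  obtain ⟨p, hpV, hp⟩ := Submodule.mem_map.1 hp
  refine ⟨p, hpV, fun v hv => ?_⟩
  have := (V.map grad).starProjection_inner_eq_zero (grad w) (grad v)
    (Submodule.mem_map_of_mem hv)
  rwa [← hp, ← map_sub] at this

/-- The Ritz projection `R w` of `w` on `V`: the element of `V` with
`(∇(w - R w), ∇v)_{L²} = 0` for all `v ∈ V`. -/
def ritz (V : Submodule ℝ (H10 d m Ω)) [FiniteDimensional ℝ V] (w : H10 d m Ω) : H10 d m Ω :=
  (exists_ritz V w).choose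

theorem ritz_mem (V : Submodule ℝ (H10 d m Ω)) [FiniteDimensional ℝ V] (w : H10 d m Ω) :
    ritz V w ∈ V := (exists_ritz V w).choose_spec.1

theorem innerH10_sub_ritz (V : Submodule ℝ (H10 d m Ω)) [FiniteDimensional ℝ V] (w : H10 d m Ω) :
    ∀ v ∈ V, innerH10 (w - ritz V w) v = 0 := (exists_ritz V w).choose_spec.2

/-- `(u_r^0, …, u_r^N)` solves the Crank-Nicolson Galerkin scheme on `V`:
`((u_r^{n+1} - u_r^n) / Δt, v) + ν (∇ u_r^{n+1/2}, ∇v) = (f^{n+1/2}, v)` for all `v ∈ V`, where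
`y^{n+1/2} = (y^{n+1} + y^n) / 2` and `f^n = f(t_n)`. -/
structure IsCrankNicolson (ν T : ℝ) (N : ℕ) (f : ℝ → L2 d m Ω) (V : Submodule ℝ (H10 d m Ω))
    (ur : ℕ → H10 d m Ω) : Prop where
  mem : ∀ n ≤ N, ur n ∈ V
  scheme : ∀ n < N, ∀ v ∈ V,
    innerL2 ((T / N)⁻¹ • (ur (n + 1) - ur n)) v
      + ν * innerH10 ((1 / 2 : ℝ) • (ur (n + 1) + ur n)) v
      = inner ℝ ((1 / 2 : ℝ) • (f (time T N (n + 1)) + f (time T N n))) (toL2 v)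

end HeatROM

end

open HeatROM

noncomputable section

namespace HeatROM

variable {d m : ℕ} {Ω : Set (EuclideanSpace ℝ (Fin d))}

/-! ### Test functions -/

/-! With `R` the Ritz projection, split `u^k - u_r^k = η^k - φ^k`, where `η = u - R u` and `φ = u_r
- R u`.

Energy estimate for `φ` (`crankNicolson_step`). The continuous equation holds at every node, so
averaging it at `t_n` and `t_{n+1}` and subtracting the scheme leaves two defects: `ρ`, the
difference quotient of `η` in `L²`, and `τ`, the difference quotient of `u` minus the mean of the
two nodal velocities. The gradient of `η` drops out by Ritz orthogonality. Testing with the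
difference quotient of `φ` makes the gradient terms telescope and lets Young's inequality absorb the
rest, with no Gronwall argument. `τ` is a trapezoidal rule error, of order `Δt⁴ ‖u_ttt‖²` after
summation (`exists_velocity`).

POD (`IsPOD.sum_norm_sq_eq`). The snapshot matrix is diagonalised by an orthogonal matrix, so for
any linear map `A` vanishing on `X^r` the sum of `‖A v^j‖²` over the `2N+1` snapshots is `2N+1`
times the truncated sum of `λ_i ‖A φ_i‖²`. Take `A = I - R`, measured in `L²` and in the gradient
norm. As the difference quotients are snapshots, this bounds `Δt ∑ ‖ρ‖²`; it also bounds the mean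
square of `∇η` and of its difference quotients, hence `∇η` at each node by a discrete Sobolev
inequality (`norm_sq_le_sum_difference`).

For the `H¹₀` basis, `R` annihilates the truncated modes and their gradients have norm one, which
turns the first bound into the second. -/

theorem IsTestFunction.continuous_fderiv_apply
    {φ : EuclideanSpace ℝ (Fin d) → EuclideanSpace ℝ (Fin m)} (hφ : IsTestFunction Ω φ)
    (e : EuclideanSpace ℝ (Fin d)) : Continuous fun x => fderiv ℝ φ x e :=
  (hφ.smooth.continuous_fderiv (by simp)).clm_apply continuous_const

theorem IsTestFunction.hasCompactSupport_fderiv_apply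
    {φ : EuclideanSpace ℝ (Fin d) → EuclideanSpace ℝ (Fin m)} (hφ : IsTestFunction Ω φ)
    (e : EuclideanSpace ℝ (Fin d)) : HasCompactSupport fun x => fderiv ℝ φ x e :=
  hφ.compactSupport.fderiv_apply (𝕜 := ℝ) e

theorem IsTestFunction.memLp
    {φ : EuclideanSpace ℝ (Fin d) → EuclideanSpace ℝ (Fin m)} (hφ : IsTestFunction Ω φ) :
    MemLp φ 2 (volume.restrict Ω) :=
  hφ.smooth.continuous.memLp_of_hasCompactSupport hφ.compactSupport

theorem IsTestFunction.memLp_fderiv_apply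
    {φ : EuclideanSpace ℝ (Fin d) → EuclideanSpace ℝ (Fin m)} (hφ : IsTestFunction Ω φ)
    (e : EuclideanSpace ℝ (Fin d)) : MemLp (fun x => fderiv ℝ φ x e) 2 (volume.restrict Ω) :=
  (hφ.continuous_fderiv_apply e).memLp_of_hasCompactSupport (hφ.hasCompactSupport_fderiv_apply e)

/-- Integration by parts against a test function. -/
theorem IsTestFunction.integral_inner_fderiv
    {φ ψ : EuclideanSpace ℝ (Fin d) → EuclideanSpace ℝ (Fin m)} (hφ : IsTestFunction Ω φ)
    (hψ : ContDiff ℝ ∞ ψ) (e : EuclideanSpace ℝ (Fin d)) :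
    ∫ x in Ω, inner ℝ (φ x) (fderiv ℝ ψ x e) = -∫ x in Ω, inner ℝ (fderiv ℝ φ x e) (ψ x) := by
  have h0 : ∀ x ∉ Ω, φ x = 0 := fun x hx =>
    image_eq_zero_of_notMem_tsupport fun h => hx (hφ.tsupport_subset h)
  have h1 : ∀ x ∉ Ω, fderiv ℝ φ x e = 0 := fun x hx => by
    have : fderiv ℝ φ x = 0 := image_eq_zero_of_notMem_tsupport fun h =>
      hx (hφ.tsupport_subset (tsupport_fderiv_subset ℝ h))
    simp [this]
  -- The integrands vanish off `Ω`; on the whole space there is no boundary term, whatever the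
  -- boundary of `Ω`.
  rw [setIntegral_eq_integral_of_forall_compl_eq_zero fun x hx => by simp [h0 x hx],
    setIntegral_eq_integral_of_forall_compl_eq_zero fun x hx => by simp [h1 x hx]]
  have hc := hφ.smooth.continuous
  have hc' := hφ.continuous_fderiv_apply e
  have hd : Continuous fun x => fderiv ℝ ψ x e :=
    (hψ.continuous_fderiv (by simp)).clm_apply continuous_const
  have hs := hφ.compactSupport
  have hs' := hφ.hasCompactSupport_fderiv_apply e
  refine integral_bilinear_fderiv_right_eq_neg_left_of_integrable
    (B := innerSL ℝ) ?_ ?_ ?_ (fun x _ => hφ.smooth.differentiable (by simp) x)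
    (fun x _ => hψ.differentiable (by simp) x)
  · exact (hc'.inner hψ.continuous).integrable_of_hasCompactSupport
      (hs'.mono fun x hx h => hx (by simp [h]))
  · exact (hc.inner hd).integrable_of_hasCompactSupport
      (hs.mono fun x hx h => hx (by simp [h]))
  · exact (hc.inner hψ.continuous).integrable_of_hasCompactSupport
      (hs.mono fun x hx h => hx (by simp [h]))

/-! ### Properties of `H¹₀` -/

/-- A closed property which is stable under linear combinations and holds for test functions
holds on `H¹₀`. -/
theorem H10_subset_of_isClosed {K : Submodule ℝ (L2 d m Ω × GradL2 d m Ω)}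
    (hK : IsClosed (K : Set (L2 d m Ω × GradL2 d m Ω)))
    (h : ∀ (p : L2 d m Ω × GradL2 d m Ω) (φ : EuclideanSpace ℝ (Fin d) → EuclideanSpace ℝ (Fin m)),
      IsTestFunction Ω φ → (p.1 : EuclideanSpace ℝ (Fin d) → _) =ᵐ[volume.restrict Ω] φ →
      (∀ i, (p.2 i : EuclideanSpace ℝ (Fin d) → _) =ᵐ[volume.restrict Ω]
        fun x => fderiv ℝ φ x (EuclideanSpace.single i 1)) → p ∈ K) :
    H10 d m Ω ≤ K :=
  Submodule.topologicalClosure_minimal _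
    (Submodule.span_le.2 fun p ⟨φ, hφ, h1, h2⟩ => h p φ hφ h1 h2) hK

/-- The second component of an element of `H¹₀` is the weak gradient of the first one. -/
theorem inner_grad_eq_neg (w : H10 d m Ω)
    {ψ : EuclideanSpace ℝ (Fin d) → EuclideanSpace ℝ (Fin m)} (hψ : IsTestFunction Ω ψ)
    (i : Fin d) :
    inner ℝ (hψ.memLp.toLp ψ) (grad w i)
      = -inner ℝ ((hψ.memLp_fderiv_apply (EuclideanSpace.single i 1)).toLp _) (toL2 w) := by
  -- The identity says that `w` lies in the kernel of a continuous functional, so test functions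
  -- suffice.
  let A : L2 d m Ω × GradL2 d m Ω →L[ℝ] ℝ :=
    (innerSL ℝ (hψ.memLp.toLp ψ)).comp
        ((PiLp.proj 2 (fun _ : Fin d => L2 d m Ω) i).comp (ContinuousLinearMap.snd ℝ _ _))
      + (innerSL ℝ ((hψ.memLp_fderiv_apply (EuclideanSpace.single i 1)).toLp _)).comp
          (ContinuousLinearMap.fst ℝ _ _)
  have hA : H10 d m Ω ≤ LinearMap.ker A.toLinearMap := by
    refine H10_subset_of_isClosed A.isClosed_ker fun p φ hφ h1 h2 => ?_
    have e1 : inner ℝ (hψ.memLp.toLp ψ) (p.2 i)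
        = ∫ x in Ω, inner ℝ (ψ x) (fderiv ℝ φ x (EuclideanSpace.single i 1)) := by
      rw [L2.inner_def]
      refine integral_congr_ae ?_
      filter_upwards [h2 i, hψ.memLp.coeFn_toLp] with x hx hx'
      rw [hx, hx']
    have e2 : inner ℝ ((hψ.memLp_fderiv_apply (EuclideanSpace.single i 1)).toLp _) p.1
        = ∫ x in Ω, inner ℝ (fderiv ℝ ψ x (EuclideanSpace.single i 1)) (φ x) := by
      rw [L2.inner_def]
      refine integral_congr_ae ?_
      filter_upwards [h1, (hψ.memLp_fderiv_apply (EuclideanSpace.single i 1)).coeFn_toLp]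
        with x hx hx'
      rw [hx, hx']
    change inner ℝ (hψ.memLp.toLp ψ) (p.2 i)
      + inner ℝ ((hψ.memLp_fderiv_apply (EuclideanSpace.single i 1)).toLp _) p.1 = 0
    rw [e1, e2, hψ.integral_inner_fderiv hφ.smooth]
    ring
  exact eq_neg_of_add_eq_zero_left (hA w.2)

/-- The zero function has zero weak gradient: pairing with `g • e`, for scalar test functions `g`
and constant vectors `e`, and the fundamental lemma of the calculus of variations give `grad w = 0`.
-/
theorem toL2_injective (hΩ : IsOpen Ω) : Function.Injective (toL2 : H10 d m Ω → L2 d m Ω) := by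
  rw [← LinearMap.ker_eq_bot, LinearMap.ker_eq_bot']
  intro w hw
  refine Subtype.ext (Prod.ext hw ?_)
  change grad w = 0
  ext1 i
  change grad w i = 0
  have hli : LocallyIntegrableOn (grad w i : EuclideanSpace ℝ (Fin d) → _) Ω volume := by
    rw [locallyIntegrableOn_iff hΩ.isLocallyClosed]
    intro k hk hkc
    have hmem := (Lp.memLp (grad w i)).restrict k
    rw [Measure.restrict_restrict hkc.measurableSet, inter_eq_left.2 hk] at hmem
    have : IsFiniteMeasure (volume.restrict k) := ⟨by simpa using hkc.measure_lt_top⟩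
    exact hmem.integrable one_le_two
  have key : ∀ᵐ x, x ∈ Ω → (grad w i : EuclideanSpace ℝ (Fin d) → _) x = 0 := by
    refine hΩ.ae_eq_zero_of_integral_contDiff_smul_eq_zero hli fun g hg hgc hgs => ?_
    have hint : ∀ e : EuclideanSpace ℝ (Fin m),
        IsTestFunction Ω fun x => g x • e := fun e =>
      ⟨hg.smul contDiff_const, hgc.smul_right,
        (tsupport_smul_subset_left g fun _ => e).trans hgs⟩
    rw [← setIntegral_eq_integral_of_forall_compl_eq_zero (s := Ω) fun x hx => by
      rw [image_eq_zero_of_notMem_tsupport fun h => hx (hgs h), zero_smul]]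
    have hgb : MemLp g 2 (volume.restrict Ω) :=
      hg.continuous.memLp_of_hasCompactSupport hgc
    have hI : Integrable (fun x => g x • (grad w i : EuclideanSpace ℝ (Fin d) → _) x)
        (volume.restrict Ω) :=
      memLp_one_iff_integrable.1 ((Lp.memLp (grad w i)).smul hgb)
    refine ext_inner_left ℝ fun e => ?_
    rw [← integral_inner hI e, inner_zero_right]
    have h := inner_grad_eq_neg w (hint e) i
    rw [hw, inner_zero_right, neg_zero, L2.inner_def] at h
    rw [← h]
    refine integral_congr_ae ?_
    filter_upwards [(hint e).memLp.coeFn_toLp] with x hx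
    rw [hx, real_inner_smul_left, real_inner_smul_right]
  rw [Lp.eq_zero_iff_ae_eq_zero]
  exact (ae_restrict_iff' hΩ.measurableSet).2 key

theorem norm_sq_eq_setIntegral {g : L2 d m Ω}
    {φ : EuclideanSpace ℝ (Fin d) → EuclideanSpace ℝ (Fin m)}
    (h : (g : EuclideanSpace ℝ (Fin d) → _) =ᵐ[volume.restrict Ω] φ) :
    ‖g‖ ^ 2 = ∫ x in Ω, ‖φ x‖ ^ 2 := by
  rw [← real_inner_self_eq_norm_sq, L2.inner_def]
  refine integral_congr_ae ?_
  filter_upwards [h] with x hx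
  rw [hx, real_inner_self_eq_norm_sq]

/-- Poincaré's inequality for test functions. -/
theorem IsTestFunction.integral_norm_sq_le
    {φ : EuclideanSpace ℝ (Fin d) → EuclideanSpace ℝ (Fin m)} (hφ : IsTestFunction Ω φ)
    (hΩ : IsOpen Ω) {R : ℝ} (hR : ∀ x ∈ Ω, ‖x‖ ≤ R) (i : Fin d) :
    ∫ x in Ω, ‖φ x‖ ^ 2
      ≤ (2 * R) ^ 2 * ∫ x in Ω, ‖fderiv ℝ φ x (EuclideanSpace.single i 1)‖ ^ 2 := by
  set e : EuclideanSpace ℝ (Fin d) := EuclideanSpace.single i 1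
  set φ' := fun x => fderiv ℝ φ x e
  have hcoord : ContDiff ℝ ∞ fun x : EuclideanSpace ℝ (Fin d) => x i :=
    (EuclideanSpace.proj (𝕜 := ℝ) i).contDiff
  have hder : ∀ x, fderiv ℝ (fun x => x i • φ x) x e = φ x + x i • φ' x := by
    intro x
    have h1 : HasFDerivAt (fun x : EuclideanSpace ℝ (Fin d) => x i)
        (EuclideanSpace.proj (𝕜 := ℝ) i : EuclideanSpace ℝ (Fin d) →L[ℝ] ℝ) x :=
      (EuclideanSpace.proj (𝕜 := ℝ) i).hasFDerivAt
    have h2 := h1.smul (hφ.smooth.differentiable (by simp) x).hasFDerivAt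
    change fderiv ℝ ((fun x : EuclideanSpace ℝ (Fin d) => x i) • φ) x e = _
    rw [h2.fderiv]
    simp [e, φ', add_comm]
  -- Integrating by parts against `x i • φ` gives `∫ ‖φ‖² = -2 ∫ x i * ⟪φ, ∂ᵢφ⟫`; as `|x i| ≤ R`,
  -- Young's inequality absorbs half of the left side.
  have ibp := hφ.integral_inner_fderiv (hcoord.smul hφ.smooth) e
  have i1 : Integrable (fun x => ‖φ x‖ ^ 2) (volume.restrict Ω) :=
    hφ.memLp.integrable_norm_pow two_ne_zero
  have i2 : Integrable (fun x => ‖φ' x‖ ^ 2) (volume.restrict Ω) :=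
    (hφ.memLp_fderiv_apply e).integrable_norm_pow two_ne_zero
  have i3 : Integrable (fun x => x i * inner ℝ (φ x) (φ' x)) (volume.restrict Ω) := by
    refine Continuous.integrable_of_hasCompactSupport
      (hcoord.continuous.mul (hφ.smooth.continuous.inner (hφ.continuous_fderiv_apply e)))
      (hφ.compactSupport.mono fun x hx h => hx (by simp [h]))
  have e1 : ∫ x in Ω, inner ℝ (φ x) (fderiv ℝ (fun x => x i • φ x) x e)
      = (∫ x in Ω, ‖φ x‖ ^ 2) + ∫ x in Ω, x i * inner ℝ (φ x) (φ' x) := by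
    rw [← integral_add i1 i3]
    refine integral_congr_ae (Filter.Eventually.of_forall fun x => ?_)
    simp only [hder, inner_add_right, real_inner_smul_right, real_inner_self_eq_norm_sq]
  have e2 : ∫ x in Ω, inner ℝ (fderiv ℝ φ x e) (x i • φ x)
      = ∫ x in Ω, x i * inner ℝ (φ x) (φ' x) := by
    refine integral_congr_ae (Filter.Eventually.of_forall fun x => ?_)
    simp only [φ', real_inner_smul_right, real_inner_comm (φ x)]
  change ∫ x in Ω, inner ℝ (φ x) (fderiv ℝ (fun x => x i • φ x) x e)
    = -∫ x in Ω, inner ℝ (fderiv ℝ φ x e) (x i • φ x) at ibp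
  rw [e1, e2] at ibp
  have hle : -∫ x in Ω, x i * inner ℝ (φ x) (φ' x)
      ≤ ∫ x in Ω, ((1 / 4) * ‖φ x‖ ^ 2 + R ^ 2 * ‖φ' x‖ ^ 2) := by
    rw [← integral_neg]
    refine setIntegral_mono_on i3.neg ((i1.const_mul _).add (i2.const_mul _)) hΩ.measurableSet
      fun x hx => ?_
    have hxi : |x i| ≤ R := by
      have := (PiLp.norm_apply_le x i).trans (hR x hx)
      simpa using this
    have hin := abs_real_inner_le_norm (φ x) (φ' x)
    have h3 : |x i * inner ℝ (φ x) (φ' x)| ≤ R * (‖φ x‖ * ‖φ' x‖) := by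
      rw [abs_mul]
      exact mul_le_mul hxi hin (abs_nonneg _) ((abs_nonneg _).trans hxi)
    nlinarith [neg_le_abs (x i * inner ℝ (φ x) (φ' x)), sq_nonneg (‖φ x‖ / 2 - R * ‖φ' x‖)]
  rw [integral_add (i1.const_mul _) (i2.const_mul _), integral_const_mul,
    integral_const_mul] at hle
  change _ ≤ _ * ∫ x in Ω, ‖φ' x‖ ^ 2
  linarith

/-- Poincaré's inequality. -/
theorem exists_norm_toL2_le (hd : 0 < d) (hΩ : IsOpen Ω) (hΩb : Bornology.IsBounded Ω) :
    ∃ K : ℝ, ∀ w : H10 d m Ω, ‖toL2 w‖ ≤ K * ‖grad w‖ := by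
  obtain ⟨R, hRpos, hR⟩ := hΩb.exists_pos_norm_le
  refine ⟨2 * R, fun w => ?_⟩
  have hcl : IsClosed {p : L2 d m Ω × GradL2 d m Ω | ‖p.1‖ ≤ 2 * R * ‖p.2‖} :=
    isClosed_le (by fun_prop) (by fun_prop)
  refine closure_minimal (fun p hp => ?_) hcl w.2
  -- The inequality does not define a subspace, so span induction cannot carry it. Instead, each
  -- element of the span is shown to come from a single test function.
  obtain ⟨φ, hφ, h1, h2⟩ : ∃ φ : EuclideanSpace ℝ (Fin d) → EuclideanSpace ℝ (Fin m),
      IsTestFunction Ω φ ∧ (p.1 : EuclideanSpace ℝ (Fin d) → _) =ᵐ[volume.restrict Ω] φ ∧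
      ∀ i, (p.2 i : EuclideanSpace ℝ (Fin d) → _) =ᵐ[volume.restrict Ω]
        fun x => fderiv ℝ φ x (EuclideanSpace.single i 1) := by
    refine Submodule.span_induction (fun p hp => hp) ?_ ?_ ?_ hp
    · refine ⟨0, ⟨contDiff_const, HasCompactSupport.zero, by simp⟩, Lp.coeFn_zero _ _ _,
        fun i => ?_⟩
      filter_upwards [Lp.coeFn_zero (EuclideanSpace ℝ (Fin m)) 2 (volume.restrict Ω)] with x hx
      simpa using hx
    · rintro p q - - ⟨φ, hφ, hp1, hp2⟩ ⟨ψ, hψ, hq1, hq2⟩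
      refine ⟨φ + ψ, ⟨hφ.smooth.add hψ.smooth, hφ.compactSupport.add hψ.compactSupport,
        (tsupport_add φ ψ).trans (union_subset hφ.tsupport_subset hψ.tsupport_subset)⟩,
        (Lp.coeFn_add _ _).trans (hp1.add hq1), fun i => ?_⟩
      filter_upwards [Lp.coeFn_add (p.2 i) (q.2 i), hp2 i, hq2 i] with x hx hx1 hx2
      rw [fderiv_add (hφ.smooth.differentiable (by simp) x) (hψ.smooth.differentiable (by simp) x)]
      simpa [hx1, hx2] using hx
    · rintro c p - ⟨φ, hφ, hp1, hp2⟩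
      refine ⟨c • φ, ⟨hφ.smooth.const_smul c, hφ.compactSupport.smul_left (f := fun _ => c),
        (tsupport_smul_subset_right (fun _ => c) φ).trans hφ.tsupport_subset⟩,
        (Lp.coeFn_smul _ _).trans (hp1.const_smul c), fun i => ?_⟩
      filter_upwards [Lp.coeFn_smul c (p.2 i), hp2 i] with x hx hx1
      rw [fderiv_const_smul (hφ.smooth.differentiable (by simp) x)]
      simpa [hx1] using hx
  have h3 := hφ.integral_norm_sq_le hΩ hR ⟨0, hd⟩
  rw [← norm_sq_eq_setIntegral h1, ← norm_sq_eq_setIntegral (h2 _), ← mul_pow] at h3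
  have h4 := le_of_sq_le_sq h3 (by positivity)
  exact h4.trans (mul_le_mul_of_nonneg_left (PiLp.norm_apply_le p.2 _) (by positivity))

/-- By Poincaré's inequality. This makes the gradient inner product definite, hence the Ritz
projection unique and linear. -/
theorem grad_injective (hd : 0 < d) (hΩ : IsOpen Ω) (hΩb : Bornology.IsBounded Ω) :
    Function.Injective (grad : H10 d m Ω → GradL2 d m Ω) := by
  rw [← LinearMap.ker_eq_bot, LinearMap.ker_eq_bot']
  intro w hw
  obtain ⟨K, hK⟩ := exists_norm_toL2_le (m := m) hd hΩ hΩb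
  refine Subtype.ext (Prod.ext ?_ hw)
  have := hK w
  rw [hw, norm_zero, mul_zero] at this
  exact norm_le_zero_iff.1 this

/-! ### Weak time derivatives -/

section WeakTimeDeriv

theorem MemL2Time.integrableOn {Z : Type*} [NormedAddCommGroup Z] {T : ℝ} {g : ℝ → Z} (hg : MemL2Time T g) :
    IntegrableOn g (Ioo 0 T) :=
  MemLp.integrable one_le_two hg

variable {Z : Type*} [NormedAddCommGroup Z] [NormedSpace ℝ Z] {T : ℝ}

/-- A test function on `(0, T)` with vanishing integral is the derivative of a test function. -/
theorem exists_test_deriv_eq {θ : ℝ → ℝ} (hθ : ContDiff ℝ ∞ θ) (hc : HasCompactSupport θ)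
    (hs : tsupport θ ⊆ Ioo 0 T) (h0 : ∫ t, θ t = 0) :
    ∃ ψ : ℝ → ℝ, ContDiff ℝ ∞ ψ ∧ HasCompactSupport ψ ∧ tsupport ψ ⊆ Ioo 0 T ∧
      deriv ψ = θ := by
  rcases (tsupport θ).eq_empty_or_nonempty with he | hne
  · have : θ = 0 := tsupport_eq_empty_iff.1 he
    exact ⟨0, contDiff_const, HasCompactSupport.zero, by simp, by simp [this]⟩
  obtain ⟨a, haK, ha⟩ := IsCompact.exists_isLeast hc hne
  obtain ⟨b, hbK, hb⟩ := IsCompact.exists_isGreatest hc hne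
  have hθ0 : ∀ t, t ∉ Icc a b → θ t = 0 := fun t ht =>
    image_eq_zero_of_notMem_tsupport fun h => ht ⟨ha h, hb h⟩
  -- Left of the support of `θ` the primitive vanishes; right of it, it equals the full integral,
  -- which is zero.
  set ψ : ℝ → ℝ := fun t => ∫ s in (0 : ℝ)..t, θ s
  have hder : deriv ψ = θ := funext fun t => hθ.continuous.deriv_integral θ 0 t
  have hψ0 : ∀ t, t ∉ Icc a b → ψ t = 0 := by
    intro t ht
    rcases lt_or_ge t a with hta | hta
    · refine intervalIntegral.integral_zero_ae (Filter.Eventually.of_forall fun s hs' => hθ0 s ?_)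
      intro hsab
      have := (uIoc_subset_uIcc hs').2
      have := (hs haK).1
      have := max_lt (hs haK).1 hta
      linarith [hsab.1]
    · have htb : b < t := lt_of_not_ge fun h => ht ⟨hta, h⟩
      rw [← h0]
      refine intervalIntegral.integral_eq_integral_of_support_subset fun s hs' => ?_
      have h1 := subset_tsupport θ hs'
      exact ⟨(hs h1).1, (hb h1).trans htb.le⟩
  refine ⟨ψ, ?_, HasCompactSupport.intro isCompact_Icc hψ0, ?_, hder⟩
  · refine contDiff_infty_iff_deriv.2 ⟨fun t => ?_, hder ▸ hθ⟩
    exact (hθ.continuous.integral_hasStrictDerivAt 0 t).hasDerivAt.differentiableAt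
  · have : tsupport ψ ⊆ Icc a b := closure_minimal
      (fun t ht => by_contra fun h => ht (hψ0 t h)) isClosed_Icc
    exact fun t ht => ⟨(hs haK).1.trans_le (this ht).1, (this ht).2.trans_lt (hs hbK).2⟩

theorem integrableOn_smul_of_test {ψ : ℝ → ℝ} (hψ : Continuous ψ) (hc : HasCompactSupport ψ)
    {w : ℝ → Z} {s : Set ℝ} (hw : IntegrableOn w s) : IntegrableOn (fun t => ψ t • w t) s := by
  obtain ⟨C, hC⟩ := hc.exists_bound_of_continuous hψ
  exact hw.bdd_smul C hψ.aestronglyMeasurable (Filter.Eventually.of_forall hC)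

/-- The du Bois-Reymond lemma. -/
theorem exists_ae_eq_const [CompleteSpace Z] (hT : 0 < T) {w : ℝ → Z}
    (hw : IntegrableOn w (Ioo 0 T))
    (h : ∀ ψ : ℝ → ℝ, ContDiff ℝ ∞ ψ → HasCompactSupport ψ → tsupport ψ ⊆ Ioo 0 T →
      ∫ t in Ioo 0 T, deriv ψ t • w t = 0) :
    ∃ c : Z, ∀ᵐ t ∂volume.restrict (Ioo 0 T), w t = c := by
  -- `ρ` has integral one and support in `[T/4, 3T/4]`. Subtracting `(∫ g) • ρ` from a test function
  -- `g` leaves integral zero, hence a derivative of a test function; so `c` is the `ρ`-average of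
  -- `w`.
  let η : ContDiffBump (T / 2) := ⟨T / 8, T / 4, by linarith, by linarith⟩
  set ρ : ℝ → ℝ := η.normed volume
  have hρ : ContDiff ℝ ∞ ρ := η.contDiff_normed
  have hρc : HasCompactSupport ρ := η.hasCompactSupport_normed
  have hρs : tsupport ρ ⊆ Ioo 0 T := by
    rw [η.tsupport_normed_eq, Real.closedBall_eq_Icc]
    exact fun t ht => ⟨by have := ht.1; simp only [η] at this; linarith,
      by have := ht.2; simp only [η] at this; linarith⟩
  have hρi : ∫ t, ρ t = 1 := η.integral_normed
  set c : Z := ∫ t in Ioo 0 T, ρ t • w t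
  refine ⟨c, ?_⟩
  have hcI : IntegrableOn (fun _ : ℝ => c) (Ioo 0 T) := integrableOn_const (by simp)
  have key : ∀ᵐ t, t ∈ Ioo 0 T → w t - c = 0 := by
    refine isOpen_Ioo.ae_eq_zero_of_integral_contDiff_smul_eq_zero
      (hw.sub hcI).locallyIntegrableOn fun g hg hgc hgs => ?_
    have hI1 := integrableOn_smul_of_test hg.continuous hgc hw
    have hI2 := integrableOn_smul_of_test hρ.continuous hρc hw
    have hI3 := integrableOn_smul_of_test hg.continuous hgc hcI
    have hgi := hg.continuous.integrable_of_hasCompactSupport hgc (μ := volume)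
    have hρI := hρ.continuous.integrable_of_hasCompactSupport hρc (μ := volume)
    set a := ∫ t, g t
    obtain ⟨ψ, hψ1, hψ2, hψ3, hψ4⟩ := exists_test_deriv_eq (T := T)
      (θ := fun t => g t - a * ρ t)
      (hg.sub (contDiff_const.mul hρ)) (hgc.sub hρc.mul_left)
      ((tsupport_sub _ _).trans (union_subset hgs ((tsupport_mul_subset_right).trans hρs)))
      (by rw [integral_sub hgi (hρI.const_mul a), integral_const_mul, hρi, mul_one, sub_self])
    have h1 := h ψ hψ1 hψ2 hψ3
    simp only [hψ4, sub_smul, mul_smul] at h1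
    rw [integral_sub hI1 (hI2.fun_smul a), integral_smul, sub_eq_zero] at h1
    rw [← setIntegral_eq_integral_of_forall_compl_eq_zero (s := Ioo 0 T) fun x hx => by
      rw [image_eq_zero_of_notMem_tsupport fun h => hx (hgs h), zero_smul]]
    simp only [smul_sub]
    rw [integral_sub hI1 hI3, h1, integral_smul_const,
      setIntegral_eq_integral_of_forall_compl_eq_zero (s := Ioo 0 T) fun x hx =>
      image_eq_zero_of_notMem_tsupport fun h => hx (hgs h), sub_self]
  refine (ae_restrict_iff' measurableSet_Ioo).2 ?_
  filter_upwards [key] with t ht hts using sub_eq_zero.1 (ht hts)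

/-- Integration by parts against a primitive of an integrable function. -/
theorem integral_deriv_smul_primitive [CompleteSpace Z] {g : ℝ → Z}
    (hg : IntegrableOn g (Ioo 0 T))
    {ψ : ℝ → ℝ} (hψ : ContDiff ℝ ∞ ψ) (hψc : HasCompactSupport ψ) (hψs : tsupport ψ ⊆ Ioo 0 T) :
    ∫ t in Ioo 0 T, deriv ψ t • ∫ s in (0 : ℝ)..t, g s = -∫ t in Ioo 0 T, ψ t • g t := by
  have hd : Continuous (deriv ψ) := hψ.continuous_deriv (by simp)
  have hdI : IntegrableOn (deriv ψ) (Ioo 0 T) :=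
    (hd.integrable_of_hasCompactSupport hψc.deriv).integrableOn
  have hψT : ψ T = 0 := image_eq_zero_of_notMem_tsupport fun h => (hψs h).2.false
  -- Fubini on the triangle `s ≤ t`: the inner integral of `deriv ψ` over `[s, T]` is `-ψ s`, since
  -- `ψ T = 0`.
  set S : Set (ℝ × ℝ) := {p | p.2 ≤ p.1}
  have hS : MeasurableSet S := measurableSet_le measurable_snd measurable_fst
  have hF : Integrable (S.indicator fun p : ℝ × ℝ => deriv ψ p.1 • g p.2)
      ((volume.restrict (Ioo 0 T)).prod (volume.restrict (Ioo 0 T))) :=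
    (hdI.smul_prod hg).indicator hS
  have e1 : ∫ t in Ioo 0 T, deriv ψ t • ∫ s in (0 : ℝ)..t, g s
      = ∫ t in Ioo 0 T, ∫ s in Ioo 0 T, S.indicator (fun p => deriv ψ p.1 • g p.2) (t, s) := by
    refine setIntegral_congr_fun measurableSet_Ioo fun t ht => ?_
    have : ∀ s, S.indicator (fun p : ℝ × ℝ => deriv ψ p.1 • g p.2) (t, s)
        = (Iic t).indicator (fun s => deriv ψ t • g s) s := fun s => by
      simp only [indicator, S, mem_ofPred_eq, mem_Iic]
    simp only [this]
    rw [setIntegral_indicator measurableSet_Iic, integral_smul,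
      intervalIntegral.integral_of_le ht.1.le]
    have : Ioo 0 T ∩ Iic t = Ioc 0 t := by
      ext s
      simp only [mem_inter_iff, mem_Ioo, mem_Iic, mem_Ioc]
      exact ⟨fun h => ⟨h.1.1, h.2⟩, fun h => ⟨⟨h.1, h.2.trans_lt ht.2⟩, h.2⟩⟩
    rw [this]
  have e2 : ∫ s in Ioo 0 T, ∫ t in Ioo 0 T, S.indicator (fun p => deriv ψ p.1 • g p.2) (t, s)
      = ∫ s in Ioo 0 T, -(ψ s • g s) := by
    refine setIntegral_congr_fun measurableSet_Ioo fun s hs => ?_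
    have : ∀ t, S.indicator (fun p : ℝ × ℝ => deriv ψ p.1 • g p.2) (t, s)
        = (Ici s).indicator (fun t => deriv ψ t • g s) t := fun t => by
      simp only [indicator, S, mem_ofPred_eq, mem_Ici]
    simp only [this]
    rw [setIntegral_indicator measurableSet_Ici, integral_smul_const]
    have : Ioo 0 T ∩ Ici s = Ico s T := by
      ext t
      simp only [mem_inter_iff, mem_Ioo, mem_Ici, mem_Ico]
      exact ⟨fun h => ⟨h.2, h.1.2⟩, fun h => ⟨⟨hs.1.trans_le h.1, h.2⟩, h.1⟩⟩
    rw [this, integral_Ico_eq_integral_Ioo, ← integral_Ioc_eq_integral_Ioo,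
      ← intervalIntegral.integral_of_le hs.2.le,
      intervalIntegral.integral_deriv_eq_sub (fun t _ => hψ.differentiable (by simp) t)
        (hd.intervalIntegrable _ _), hψT, zero_sub, neg_smul]
  rw [e1, integral_integral_swap (f := fun t s =>
    S.indicator (fun p : ℝ × ℝ => deriv ψ p.1 • g p.2) (t, s)) hF, e2, integral_neg]

theorem continuousOn_primitive_Icc {g : ℝ → Z} (hg : IntegrableOn g (Ioo 0 T)) (c : Z) :
    ContinuousOn (fun t => c + ∫ s in (0 : ℝ)..t, g s) (Icc 0 T) := by
  rcases lt_or_ge T 0 with h | h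
  · simp [Icc_eq_empty_of_lt h]
  refine continuousOn_const.add ?_
  have := intervalIntegral.continuousOn_primitive_interval (f := g) (a := 0) (b := T)
    (μ := volume) (by rwa [uIcc_of_le h, integrableOn_Icc_iff_integrableOn_Ioo])
  rwa [uIcc_of_le h] at this

/-- A function with an integrable weak derivative is a primitive of it. -/
theorem IsWeakTimeDeriv.ae_eq_primitive [CompleteSpace Z] (hT : 0 < T) {z g : ℝ → Z}
    (h : IsWeakTimeDeriv T 1 z g) (hz : IntegrableOn z (Ioo 0 T)) (hg : IntegrableOn g (Ioo 0 T)) :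
    ∃ c : Z, ∀ᵐ t ∂volume.restrict (Ioo 0 T), z t = c + ∫ s in (0 : ℝ)..t, g s := by
  have hP : IntegrableOn (fun t => ∫ s in (0 : ℝ)..t, g s) (Ioo 0 T) := by
    have := ((continuousOn_primitive_Icc hg 0).integrableOn_Icc (μ := volume)).mono_set Ioo_subset_Icc_self
    simpa only [zero_add] using this
  obtain ⟨c, hc⟩ := exists_ae_eq_const hT (w := fun t => z t - ∫ s in (0 : ℝ)..t, g s)
    (hz.sub hP) fun ψ hψ hψc hψs => by
      have hd : Continuous (deriv ψ) := hψ.continuous_deriv (by simp)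
      have h1 := h ψ hψ hψc hψs
      simp only [iteratedDeriv_one, pow_one, neg_smul, one_smul] at h1
      simp only [smul_sub]
      rw [integral_sub (integrableOn_smul_of_test hd hψc.deriv hz)
        (integrableOn_smul_of_test hd hψc.deriv hP), h1,
        integral_deriv_smul_primitive hg hψ hψc hψs, sub_self]
  refine ⟨c, ?_⟩
  filter_upwards [hc] with t ht
  rw [← ht]
  abel

/-- Testing the order `k` identity with `deriv ψ` gives the left side of the order `k + 1` identity
for `ψ`. Derivatives of increasing order thus form a chain of first order ones. -/
theorem IsWeakTimeDeriv.weakDeriv_succ {k : ℕ} {z g g' : ℝ → Z} (h : IsWeakTimeDeriv T k z g)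
    (h' : IsWeakTimeDeriv T (k + 1) z g') : IsWeakTimeDeriv T 1 g g' := by
  intro ψ hψ hψc hψs
  have h1 := h (deriv ψ) (contDiff_infty_iff_deriv.1 hψ).2 hψc.deriv
    ((tsupport_deriv_subset).trans hψs)
  have h2 := h' ψ hψ hψc hψs
  rw [iteratedDeriv_succ', h1, pow_succ, mul_smul] at h2
  rw [iteratedDeriv_one, pow_one]
  have hk : ((-1 : ℝ) ^ k) ≠ 0 := pow_ne_zero _ (by norm_num)
  exact smul_right_injective Z hk h2

/-- A continuous function with square integrable weak derivatives of orders one, two and three is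
an iterated primitive of its third derivative. -/
theorem exists_iterated_primitive [CompleteSpace Z] (hT : 0 < T) {z z1 z2 z3 : ℝ → Z}
    (hz : ContinuousOn z (Icc 0 T)) (h1 : IsWeakTimeDeriv T 1 z z1) (h2 : IsWeakTimeDeriv T 2 z z2)
    (h3 : IsWeakTimeDeriv T 3 z z3) (m1 : MemL2Time T z1) (m2 : MemL2Time T z2)
    (m3 : MemL2Time T z3) :
    ∃ (V W : ℝ → Z) (c c' c'' : Z), (∀ᵐ t ∂volume.restrict (Ioo 0 T), z1 t = V t) ∧
      (∀ t ∈ Icc 0 T, z t = c + ∫ s in (0 : ℝ)..t, V s) ∧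
      (∀ t, V t = c' + ∫ s in (0 : ℝ)..t, W s) ∧ (∀ t, W t = c'' + ∫ s in (0 : ℝ)..t, z3 s) := by
  obtain ⟨c'', hc''⟩ := (h2.weakDeriv_succ h3).ae_eq_primitive hT m2.integrableOn m3.integrableOn
  obtain ⟨c', hc'⟩ := (h1.weakDeriv_succ h2).ae_eq_primitive hT m1.integrableOn m2.integrableOn
  obtain ⟨c, hc⟩ := h1.ae_eq_primitive hT
    (hz.integrableOn_Icc.mono_set Ioo_subset_Icc_self) m1.integrableOn
  have hprim : ∀ {g g' : ℝ → Z}, (∀ᵐ t ∂volume.restrict (Ioo 0 T), g t = g' t) →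
      ∀ t ∈ Icc 0 T, ∫ s in (0 : ℝ)..t, g s = ∫ s in (0 : ℝ)..t, g' s := by
    intro g g' hgg t ht
    rw [intervalIntegral.integral_of_le ht.1, intervalIntegral.integral_of_le ht.1,
      integral_Ioc_eq_integral_Ioo, integral_Ioc_eq_integral_Ioo]
    exact integral_congr_ae (ae_restrict_of_ae_restrict_of_subset
      (Ioo_subset_Ioo_right ht.2) hgg)
  set W : ℝ → Z := fun t => c'' + ∫ s in (0 : ℝ)..t, z3 s
  set V : ℝ → Z := fun t => c' + ∫ s in (0 : ℝ)..t, W s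
  have hV : ∀ᵐ t ∂volume.restrict (Ioo 0 T), z1 t = V t := by
    filter_upwards [hc', ae_restrict_mem measurableSet_Ioo] with t ht hts
    rw [ht, hprim hc'' t (Ioo_subset_Icc_self hts)]
  refine ⟨V, W, c, c', c'', hV, fun t ht => ?_, fun _ => rfl, fun _ => rfl⟩
  have hWc : ContinuousOn W (Icc 0 T) := continuousOn_primitive_Icc m3.integrableOn c''
  have hVc : ContinuousOn V (Icc 0 T) := continuousOn_primitive_Icc
    (hWc.integrableOn_Icc.mono_set Ioo_subset_Icc_self) c'
  -- Both sides are continuous on `[0, T]`, so almost everywhere equality becomes equality at every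
  -- time, in particular at the nodes.
  have heq : z =ᵐ[volume.restrict (Icc 0 T)] fun t => c + ∫ s in (0 : ℝ)..t, V s := by
    rw [← restrict_Ioo_eq_restrict_Icc]
    filter_upwards [hc, ae_restrict_mem measurableSet_Ioo] with t ht hts
    rw [ht, hprim hV t (Ioo_subset_Icc_self hts)]
  exact Measure.eqOn_Icc_of_ae_eq volume hT.ne heq hz (continuousOn_primitive_Icc
    (hVc.integrableOn_Icc.mono_set Ioo_subset_Icc_self) c) ht

end WeakTimeDeriv

/-! ### Error of the trapezoidal rule -/

section Trapezoid

/-- Cauchy-Schwarz, from the nonnegativity of the variance of `‖g‖`; `J / (b - a)` is its mean. -/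
theorem sq_integral_norm_le {Z : Type*} [NormedAddCommGroup Z] {a b : ℝ} {g : ℝ → Z}
    (hab : a < b)
    (hg : IntervalIntegrable (fun t => ‖g t‖) volume a b)
    (hg2 : IntervalIntegrable (fun t => ‖g t‖ ^ 2) volume a b) :
    (∫ t in a..b, ‖g t‖) ^ 2 ≤ (b - a) * ∫ t in a..b, ‖g t‖ ^ 2 := by
  set J := ∫ t in a..b, ‖g t‖
  have hpos : 0 < b - a := sub_pos.2 hab
  have h0 : 0 ≤ ∫ t in a..b, (‖g t‖ ^ 2 - 2 * (J / (b - a)) * ‖g t‖ + (J / (b - a)) ^ 2) :=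
    intervalIntegral.integral_nonneg hab.le fun t _ => by
      nlinarith [sq_nonneg (‖g t‖ - J / (b - a))]
  rw [intervalIntegral.integral_add (hg2.sub (hg.const_mul _)) intervalIntegrable_const,
    intervalIntegral.integral_sub hg2 (hg.const_mul _), intervalIntegral.integral_const_mul,
    intervalIntegral.integral_const, smul_eq_mul] at h0
  have h1 := mul_nonneg hpos.le h0
  have h2 : (b - a) * ((∫ t in a..b, ‖g t‖ ^ 2) - 2 * (J / (b - a)) * J
      + (b - a) * (J / (b - a)) ^ 2) = (b - a) * (∫ t in a..b, ‖g t‖ ^ 2) - J ^ 2 := by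
    field_simp
    ring
  linarith

variable {Z : Type*} [NormedAddCommGroup Z] [NormedSpace ℝ Z] {a b : ℝ}

/-- The error of the trapezoidal rule for a function whose second derivative is integrable. -/
theorem norm_integral_sub_trapezoid_le [CompleteSpace Z] (hab : a ≤ b) {V W g : ℝ → Z}
    (hg : IntervalIntegrable g volume a b) (hW : ContinuousOn W (Icc a b))
    (hV : ContinuousOn V (Icc a b))
    (hVW : ∀ t ∈ Icc a b, V t - V a = ∫ s in a..t, W s)
    (hWg : ∀ t ∈ Icc a b, W t - W a = ∫ s in a..t, g s) :
    ‖(∫ t in a..b, V t) - ((b - a) / 2) • (V a + V b)‖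
      ≤ 3 / 2 * (b - a) ^ 2 * ∫ t in a..b, ‖g t‖ := by
  set J := ∫ t in a..b, ‖g t‖
  have hJ : 0 ≤ J := intervalIntegral.integral_nonneg hab fun t _ => norm_nonneg _
  have hWa : ∀ t ∈ Icc a b, ‖W t - W a‖ ≤ J := by
    intro t ht
    rw [hWg t ht]
    refine (intervalIntegral.norm_integral_le_integral_norm ht.1).trans ?_
    exact intervalIntegral.integral_mono_interval le_rfl ht.1 ht.2
      (Filter.Eventually.of_forall fun s => norm_nonneg _) hg.norm
  have hD : ∀ t ∈ Icc a b, ‖V t - V a - (t - a) • W a‖ ≤ J * (b - a) := by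
    intro t ht
    have hsub : Icc a t ⊆ Icc a b := Icc_subset_Icc_right ht.2
    have e : V t - V a - (t - a) • W a = ∫ s in a..t, (W s - W a) := by
      rw [intervalIntegral.integral_sub ((hW.mono hsub).intervalIntegrable_of_Icc ht.1)
        intervalIntegrable_const, intervalIntegral.integral_const, hVW t ht]
    rw [e]
    refine (intervalIntegral.norm_integral_le_of_norm_le_const (C := J) fun s hs => ?_).trans ?_
    · rw [uIoc_of_le ht.1] at hs
      exact hWa s (hsub (Ioc_subset_Icc_self hs))
    · rw [abs_of_nonneg (sub_nonneg.2 ht.1)]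
      exact mul_le_mul_of_nonneg_left (by linarith [ht.2]) hJ
  have hDc : ContinuousOn (fun t => V t - V a - (t - a) • W a) (Icc a b) := by
    fun_prop
  have hlin : ∫ t in a..b, (t - a) • W a = ((b - a) ^ 2 / 2) • W a := by
    rw [intervalIntegral.integral_smul_const, intervalIntegral.integral_sub
      intervalIntegral.intervalIntegrable_id intervalIntegrable_const, integral_id, intervalIntegral.integral_const, smul_eq_mul]
    congr 1
    ring
  have hI : ∫ t in a..b, (V t - V a - (t - a) • W a)
      = (∫ t in a..b, V t) - (b - a) • V a - ((b - a) ^ 2 / 2) • W a := by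
    rw [intervalIntegral.integral_sub ((hV.intervalIntegrable_of_Icc hab).sub
      intervalIntegrable_const) (Continuous.intervalIntegrable (by fun_prop) _ _),
      intervalIntegral.integral_sub (hV.intervalIntegrable_of_Icc hab) intervalIntegrable_const,
      intervalIntegral.integral_const, hlin]
  -- The rule is exact on affine functions, so only the Taylor remainder at `a`, of size at most `J
  -- * (b - a)`, contributes: once through its integral and one half through its value at `b`,
  -- whence `3 / 2`.
  have hsplit : (∫ t in a..b, V t) - ((b - a) / 2) • (V a + V b)
      = (∫ t in a..b, (V t - V a - (t - a) • W a))
        - ((b - a) / 2) • (V b - V a - (b - a) • W a) := by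
    rw [hI]
    module
  have hb : b ∈ Icc a b := right_mem_Icc.2 hab
  have h1 : ‖∫ t in a..b, (V t - V a - (t - a) • W a)‖ ≤ J * (b - a) * (b - a) := by
    refine (intervalIntegral.norm_integral_le_of_norm_le_const fun s hs => ?_).trans
      (by rw [abs_of_nonneg (sub_nonneg.2 hab)])
    rw [uIoc_of_le hab] at hs
    exact hD s (Ioc_subset_Icc_self hs)
  have h2 : ‖((b - a) / 2) • (V b - V a - (b - a) • W a)‖ ≤ (b - a) / 2 * (J * (b - a)) := by
    rw [norm_smul, Real.norm_of_nonneg (by linarith)]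
    exact mul_le_mul_of_nonneg_left (hD b hb) (by linarith)
  rw [hsplit]
  refine (norm_sub_le _ _).trans ?_
  nlinarith

end Trapezoid

/-! ### Consequences of the regularity of the heat solution -/

section Heat

variable {ν T : ℝ} {u : ℝ → H10 d m Ω} {f : ℝ → L2 d m Ω}

/-- If the weak form with continuous data holds almost everywhere in time, then it holds
everywhere. -/
theorem weak_form_of_ae (hΩ : IsOpen Ω) (hν : 0 < ν) (hT : 0 < T) {g : ℝ → L2 d m Ω}
    (hu : ContinuousOn (fun t => toL2 (u t)) (Icc 0 T)) (hg : ContinuousOn g (Icc 0 T))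
    (h : ∀ᵐ t ∂volume.restrict (Ioo 0 T), ∀ v : H10 d m Ω,
      ν * inner ℝ (grad (u t)) (grad v) = inner ℝ (g t) (toL2 v)) :
    ∀ t ∈ Icc 0 T, ∀ v : H10 d m Ω,
      ν * inner ℝ (grad (u t)) (grad v) = inner ℝ (g t) (toL2 v) := by
  intro t ht v
  -- The good times have full measure, hence are dense, and `t` is a limit of them.
  have hcl : t ∈ closure (Ioo 0 T ∩ {t | t ∈ Ioo 0 T → ∀ v : H10 d m Ω,
      ν * inner ℝ (grad (u t)) (grad v) = inner ℝ (g t) (toL2 v)}) := by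
    have hd := Measure.dense_of_ae ((ae_restrict_iff' measurableSet_Ioo).1 h)
    rw [← closure_Ioo hT.ne] at ht
    exact closure_minimal (hd.open_subset_closure_inter isOpen_Ioo) isClosed_closure ht
  obtain ⟨s, hs, hst⟩ := mem_closure_iff_seq_limit.1 hcl
  have hsI : ∀ n, s n ∈ Icc 0 T := fun n => Ioo_subset_Icc_self (hs n).1
  have hw : ∀ n, ∀ v : H10 d m Ω,
      ν * inner ℝ (grad (u (s n))) (grad v) = inner ℝ (g (s n)) (toL2 v) :=
    fun n => (hs n).2 (hs n).1
  have hstI : Filter.Tendsto s Filter.atTop (nhdsWithin t (Icc 0 T)) :=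
    tendsto_nhdsWithin_iff.2 ⟨hst, Filter.Eventually.of_forall hsI⟩
  have hgt : Filter.Tendsto (fun n => g (s n)) Filter.atTop (nhds (g t)) := (hg t ht).tendsto.comp hstI
  have hut : Filter.Tendsto (fun n => toL2 (u (s n))) Filter.atTop (nhds (toL2 (u t))) :=
    (hu t ht).tendsto.comp hstI
  -- Subtract the weak forms at two good times and test with the difference of the solutions:
  -- convergence of `g` and `u` in `L²` forces convergence of the gradients.
  have hcauchy : CauchySeq fun n => grad (u (s n)) := by
    have hy := (hgt.prodMk_nhds hut).cauchySeq
    have hbound : ∀ k j, dist (grad (u (s k))) (grad (u (s j)))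
        ≤ √ν⁻¹ * dist (g (s k), toL2 (u (s k))) (g (s j), toL2 (u (s j))) := by
      intro k j
      set D := dist (g (s k), toL2 (u (s k))) (g (s j), toL2 (u (s j)))
      have hD1 : ‖g (s k) - g (s j)‖ ≤ D := by
        rw [← dist_eq_norm]; exact le_max_left _ _
      have hD2 : ‖toL2 (u (s k) - u (s j))‖ ≤ D := by
        rw [map_sub, ← dist_eq_norm]; exact le_max_right _ _
      have h1 : ν * ‖grad (u (s k) - u (s j))‖ ^ 2
          = inner ℝ (g (s k) - g (s j)) (toL2 (u (s k) - u (s j))) := by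
        rw [inner_sub_left, ← hw, ← hw, ← real_inner_self_eq_norm_sq, ← mul_sub,
          ← inner_sub_left, ← map_sub]
      have h2 : ν * ‖grad (u (s k) - u (s j))‖ ^ 2 ≤ D ^ 2 := by
        rw [h1, sq]
        exact (real_inner_le_norm _ _).trans
          (mul_le_mul hD1 hD2 (norm_nonneg _) dist_nonneg)
      rw [dist_eq_norm, ← map_sub]
      refine le_of_sq_le_sq ?_ (by positivity)
      rw [mul_pow, Real.sq_sqrt (by positivity), inv_mul_eq_div, le_div_iff₀ hν]
      linarith
    rw [Metric.cauchySeq_iff'] at hy ⊢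
    intro ε hε
    obtain ⟨n0, hn0⟩ := hy (ε / (√ν⁻¹ + 1)) (by positivity)
    refine ⟨n0, fun n hn => (hbound n n0).trans_lt ?_⟩
    have := hn0 n hn
    rw [lt_div_iff₀ (by positivity)] at this
    nlinarith [dist_nonneg (x := (g (s n), toL2 (u (s n)))) (y := (g (s n0), toL2 (u (s n0))))]
  obtain ⟨G, hG⟩ := cauchySeq_tendsto_of_complete hcauchy
  have hmem : (toL2 (u t), G) ∈ H10 d m Ω :=
    (Submodule.isClosed_topologicalClosure _).mem_of_tendsto (hut.prodMk_nhds hG)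
      (Filter.Eventually.of_forall fun n => (u (s n)).2)
  -- `H10` is closed and an element is determined by its `L²` component, which identifies the limit
  -- gradient.
  have hGu : G = grad (u t) := by
    have : (⟨_, hmem⟩ : H10 d m Ω) = u t := toL2_injective hΩ rfl
    rw [← this]
    rfl
  rw [← hGu]
  refine tendsto_nhds_unique ((hG.inner tendsto_const_nhds).const_mul ν) ?_
  simp only [hw]
  exact hgt.inner tendsto_const_nhds

/-- For a regular heat solution the velocity `V = u_t` is continuous, the weak form holds at all
times, and the difference quotients of `u` approximate the mean velocity to second order. -/
theorem exists_velocity (hΩ : IsOpen Ω) (hν : 0 < ν) (hT : 0 < T)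
    {uttt Δutt ftt : ℝ → L2 d m Ω} (hu : IsHeatSolution ν T u f)
    (hr : HasRegularity T u f uttt Δutt ftt) :
    ∃ V : ℝ → L2 d m Ω,
      (∀ t ∈ Icc 0 T, ∀ v : H10 d m Ω,
        inner ℝ (V t) (toL2 v) + ν * inner ℝ (grad (u t)) (grad v) = inner ℝ (f t) (toL2 v)) ∧
      ∀ a b, 0 ≤ a → a < b → b ≤ T →
        ‖(b - a)⁻¹ • (toL2 (u b) - toL2 (u a)) - (1 / 2 : ℝ) • (V b + V a)‖ ^ 2
          ≤ 9 / 4 * (b - a) ^ 3 * ∫ t in a..b, ‖uttt t‖ ^ 2 := by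
  obtain ⟨ut, hut, hut1, hweak⟩ := hu.weak_form
  obtain ⟨utt, hutt, hutt2, -⟩ := hr.deriv_lap_utt
  obtain ⟨V, W, c, c', c'', hV, hzV, hVW, hWg⟩ := exists_iterated_primitive hT hu.continuousOn_u
    hut1 hutt2 hr.deriv_uttt hut hutt hr.memL2_uttt
  have hgI := hr.memL2_uttt.integrableOn
  have hWc : ContinuousOn W (Icc 0 T) :=
    (continuousOn_primitive_Icc hgI c'').congr fun t _ => hWg t
  have hWI : IntegrableOn W (Ioo 0 T) := hWc.integrableOn_Icc.mono_set Ioo_subset_Icc_self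
  have hVc : ContinuousOn V (Icc 0 T) :=
    (continuousOn_primitive_Icc hWI c').congr fun t _ => hVW t
  have hVI : IntegrableOn V (Ioo 0 T) := hVc.integrableOn_Icc.mono_set Ioo_subset_Icc_self
  refine ⟨V, fun t ht v => ?_, fun a b ha hab hb => ?_⟩
  · have := weak_form_of_ae (g := fun t => f t - V t) hΩ hν hT hu.continuousOn_u
      (hu.continuousOn_f.sub hVc) (by
        filter_upwards [hweak, hV] with t h1 h2 v
        rw [inner_sub_left, ← h1 v, h2]
        ring) t ht v
    rw [this, inner_sub_left]
    ring
  have hII : ∀ {E : Type _} [NormedAddCommGroup E] {g : ℝ → E}, IntegrableOn g (Ioo 0 T) →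
      ∀ x y, 0 ≤ x → x ≤ y → y ≤ T → IntervalIntegrable g volume x y := by
    intro E _ g hg x y hx hxy hy
    rw [intervalIntegrable_iff_integrableOn_Ioo_of_le hxy]
    exact hg.mono_set (Ioo_subset_Ioo hx hy)
  have hdiff : ∀ {F g : ℝ → L2 d m Ω} {c : L2 d m Ω}, IntegrableOn g (Ioo 0 T) →
      (∀ t ∈ Icc 0 T, F t = c + ∫ s in (0 : ℝ)..t, g s) →
      ∀ t ∈ Icc a b, F t - F a = ∫ s in a..t, g s := by
    intro F g c hg hF t ht
    have haT : a ≤ T := hab.le.trans hb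
    have htT : t ≤ T := ht.2.trans hb
    rw [hF t ⟨ha.trans ht.1, htT⟩, hF a ⟨ha, haT⟩, add_sub_add_left_eq_sub,
      intervalIntegral.integral_interval_sub_left
        (hII hg 0 t le_rfl (ha.trans ht.1) htT) (hII hg 0 a le_rfl ha haT)]
  have hsub : Icc a b ⊆ Icc 0 T := Icc_subset_Icc ha hb
  have hpos : 0 < b - a := sub_pos.2 hab
  have htr := norm_integral_sub_trapezoid_le hab.le (hII hgI a b ha hab.le hb) (hWc.mono hsub)
    (hVc.mono hsub) (hdiff hWI fun t _ => hVW t) (hdiff hgI fun t _ => hWg t)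
  have hcs := sq_integral_norm_le hab (hII hgI.norm a b ha hab.le hb)
    (hII (MemLp.integrable_norm_pow hr.memL2_uttt two_ne_zero) a b ha hab.le hb)
  rw [← hdiff hVI hzV b (right_mem_Icc.2 hab.le)] at htr
  have e : (b - a)⁻¹ • (toL2 (u b) - toL2 (u a)) - (1 / 2 : ℝ) • (V b + V a)
      = (b - a)⁻¹ • (toL2 (u b) - toL2 (u a) - ((b - a) / 2) • (V a + V b)) := by
    rw [smul_sub (b - a)⁻¹ (toL2 (u b) - toL2 (u a)), smul_smul, add_comm (V b)]
    congr 2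
    field_simp
  rw [e, norm_smul, norm_inv, Real.norm_of_nonneg hpos.le, inv_mul_eq_div, div_pow,
    div_le_iff₀ (by positivity)]
  -- Powers of `b - a`: four from the squared trapezoidal error, one from Cauchy-Schwarz, minus two
  -- from the squared quotient.
  calc _ ≤ (3 / 2 * (b - a) ^ 2 * ∫ t in a..b, ‖uttt t‖) ^ 2 :=
        pow_le_pow_left₀ (norm_nonneg _) htr 2
    _ = 9 / 4 * (b - a) ^ 4 * (∫ t in a..b, ‖uttt t‖) ^ 2 := by ring
    _ ≤ 9 / 4 * (b - a) ^ 4 * ((b - a) * ∫ t in a..b, ‖uttt t‖ ^ 2) := by gcongr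
    _ = _ := by ring

end Heat

/-! ### Proper orthogonal decomposition -/

section POD

variable {E F G : Type*} [AddCommGroup E] [Module ℝ E]
  [NormedAddCommGroup F] [InnerProductSpace ℝ F] [NormedAddCommGroup G] [InnerProductSpace ℝ G]
  {M : ℕ} {v : Fin M → E} {lam : Fin M → ℝ} {z : Fin M → EuclideanSpace ℝ (Fin M)}

theorem sum_mul_of_orthonormal (hz : Orthonormal ℝ z) (i l : Fin M) :
    ∑ k, z i k * z l k = if i = l then 1 else 0 := by
  rw [← orthonormal_iff_ite.1 hz i l, PiLp.inner_apply]
  exact Finset.sum_congr rfl fun k _ => by simp [mul_comm]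

/-- A square matrix with orthonormal rows has orthonormal columns. -/
theorem sum_mul_of_orthonormal' (hz : Orthonormal ℝ z) (k j : Fin M) :
    ∑ i, z i k * z i j = if k = j then 1 else 0 := by
  have h1 : (Matrix.of fun i k => z i k) * (Matrix.of fun i k => z i k).transpose = 1 := by
    ext i l
    rw [Matrix.mul_apply, Matrix.one_apply, ← sum_mul_of_orthonormal hz i l]
    rfl
  have h2 := mul_eq_one_comm.1 h1
  have h3 := congrFun (congrFun h2 k) j
  rw [Matrix.mul_apply, Matrix.one_apply] at h3
  exact h3

/-- An orthogonal change of coefficients preserves the sum of squares. -/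
theorem sum_norm_sq_orthonormal_comb (hz : Orthonormal ℝ z) (a : Fin M → F) :
    ∑ i, ‖∑ k, z i k • a k‖ ^ 2 = ∑ j, ‖a j‖ ^ 2 := by
  have h : ∀ i, ‖∑ k, z i k • a k‖ ^ 2 = ∑ k, ∑ j, z i k * z i j * inner ℝ (a k) (a j) := by
    intro i
    rw [← real_inner_self_eq_norm_sq, sum_inner]
    refine Finset.sum_congr rfl fun k _ => ?_
    rw [inner_sum]
    refine Finset.sum_congr rfl fun j _ => ?_
    rw [real_inner_smul_left, real_inner_smul_right, mul_assoc]
  simp only [h]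
  rw [Finset.sum_comm]
  refine Finset.sum_congr rfl fun k _ => ?_
  rw [Finset.sum_comm]
  simp only [← Finset.sum_mul, sum_mul_of_orthonormal' hz, ite_mul, one_mul, zero_mul]
  simp

/-- For a decreasing sequence the positive entries form an initial segment, whose length is their
number. -/
theorem pos_iff_lt_podRank (hlam : Antitone lam) (i : Fin M) : 0 < lam i ↔ (i : ℕ) < podRank lam := by
  constructor
  · intro hi
    have : Finset.Iic i ⊆ Finset.univ.filter fun i => 0 < lam i := fun j hj =>
      Finset.mem_filter.2 ⟨Finset.mem_univ _, hi.trans_le (hlam (Finset.mem_Iic.1 hj))⟩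
    have := Finset.card_le_card this
    rw [Fin.card_Iic] at this
    exact this
  · intro hi
    by_contra hneg
    have : (Finset.univ.filter fun i => 0 < lam i) ⊆ Finset.Iio i := fun j hj =>
      Finset.mem_Iio.2 (lt_of_not_ge fun hij =>
        hneg ((Finset.mem_filter.1 hj).2.trans_le (hlam hij)))
    have := Finset.card_le_card this
    rw [Fin.card_Iio] at this
    exact absurd hi (not_lt.2 this)

/-- The Gram matrix of the snapshots is `M` times the correlation matrix, which the eigenvectors
diagonalise. -/
theorem IsPOD.inner_comb {J : E →ₗ[ℝ] G} (hM : 0 < M)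
    (h : IsPOD (fun a b => inner ℝ (J a) (J b)) v lam z) (i l : Fin M) :
    inner ℝ (J (∑ k, z i k • v k)) (J (∑ k, z l k • v k)) = if i = l then M * lam i else 0 := by
  have hM' : (M : ℝ) ≠ 0 := by positivity
  have hk : ∀ k, ∑ j, z l j * inner ℝ (J (v k)) (J (v j)) = M * (lam l * z l k) := by
    intro k
    have := congrFun (h.eigen l) k
    simp only [Matrix.mulVec, dotProduct, corrMatrix, Matrix.of_apply, Pi.smul_apply,
      smul_eq_mul] at this
    rw [← this, Finset.mul_sum]
    refine Finset.sum_congr rfl fun j _ => ?_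
    field_simp
  have hk' : ∀ k, inner ℝ (J (v k)) (∑ j, z l j • J (v j)) = M * (lam l * z l k) := by
    intro k
    rw [inner_sum, ← hk]
    exact Finset.sum_congr rfl fun j _ => real_inner_smul_right _ _ _
  simp only [map_sum, map_smul]
  rw [sum_inner]
  simp only [real_inner_smul_left, hk']
  calc ∑ k, z i k * (M * (lam l * z l k)) = M * lam l * ∑ k, z i k * z l k := by
        rw [Finset.mul_sum]
        exact Finset.sum_congr rfl fun k _ => by ring
    _ = _ := by
        rw [sum_mul_of_orthonormal h.orthonormal]
        split_ifs with hil
        · rw [hil, mul_one]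
        · rw [mul_zero]

theorem sum_smul_eq_smul_podMode (hM : 0 < M) {i : Fin M} (hi : 0 < lam i) :
    ∑ k, z i k • v k = (√(lam i) * √(M : ℝ)) • podMode v lam z i := by
  have hM' : (0 : ℝ) < M := by positivity
  rw [podMode, smul_smul]
  have h1 : √(lam i) ≠ 0 := (Real.sqrt_pos.2 hi).ne'
  have h2 : √(M : ℝ) ≠ 0 := (Real.sqrt_pos.2 hM').ne'
  rw [show √(lam i) * √(M : ℝ) * ((√(lam i))⁻¹ * (√(M : ℝ))⁻¹) = 1 by field_simp, one_smul]

theorem IsPOD.inner_podMode {J : E →ₗ[ℝ] G} (hM : 0 < M)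
    (h : IsPOD (fun a b => inner ℝ (J a) (J b)) v lam z) {i : Fin M} (hi : 0 < lam i) (l : Fin M) :
    inner ℝ (J (podMode v lam z i)) (J (podMode v lam z l)) = if i = l then 1 else 0 := by
  have hM' : (0 : ℝ) < M := by positivity
  have h2 : √(M : ℝ) ≠ 0 := (Real.sqrt_pos.2 hM').ne'
  rw [podMode, podMode, map_smul, map_smul, real_inner_smul_left, real_inner_smul_right,
    h.inner_comb hM]
  split_ifs with hil
  · subst hil
    have h1 : √(lam i) ≠ 0 := (Real.sqrt_pos.2 hi).ne'
    field_simp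
    rw [Real.sq_sqrt hi.le, Real.sq_sqrt hM'.le]
    ring
  · simp

/-- The POD projection error formula for a linear map vanishing on the POD space. -/
theorem IsPOD.sum_norm_sq_eq {J : E →ₗ[ℝ] G} (hJ : Function.Injective J) (hM : 0 < M)
    (h : IsPOD (fun a b => inner ℝ (J a) (J b)) v lam z) (A : E →ₗ[ℝ] F) {r : ℕ}
    (hA : ∀ x ∈ podSpace v lam z r, A x = 0) :
    ∑ j, ‖A (v j)‖ ^ 2 = M * ∑ i ∈ truncated lam r, lam i * ‖A (podMode v lam z i)‖ ^ 2 := by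
  have hM' : (0 : ℝ) < M := by positivity
  -- After rotating the snapshots by the eigenvectors, each term is a multiple of a mode when `lam i
  -- > 0`; it is killed by `A` if `i < r`.
  rw [← sum_norm_sq_orthonormal_comb h.orthonormal, truncated, Finset.sum_filter, Finset.mul_sum]
  refine Finset.sum_congr rfl fun i _ => ?_
  have e : ∑ k, z i k • A (v k) = A (∑ k, z i k • v k) := by simp only [map_sum, map_smul]
  rw [e]
  simp only [← pos_iff_lt_podRank h.antitone]
  rcases lt_or_ge 0 (lam i) with hi | hi
  · rw [sum_smul_eq_smul_podMode hM hi, map_smul, norm_smul, mul_pow, Real.norm_of_nonneg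
      (by positivity), mul_pow, Real.sq_sqrt hi.le, Real.sq_sqrt hM'.le]
    split_ifs with hri
    · ring
    · have hri' : (i : ℕ) < r := by
        by_contra hcon
        exact hri ⟨not_lt.1 hcon, hi⟩
      rw [hA _ (Submodule.subset_span (mem_image_of_mem _ hri'))]
      simp
  -- Without a positive eigenvalue the combination has `J`-norm zero, so it vanishes by injectivity
  -- of `J`.
  · have h0 := h.inner_comb hM i i
    rw [if_pos rfl, real_inner_self_eq_norm_sq] at h0
    have h1 : M * lam i ≤ 0 := mul_nonpos_of_nonneg_of_nonpos hM'.le hi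
    have h2 : J (∑ k, z i k • v k) = 0 := by
      rw [← norm_eq_zero, ← sq_eq_zero_iff]
      exact le_antisymm (h0 ▸ h1) (sq_nonneg _)
    rw [(map_eq_zero_iff J hJ).1 h2, if_neg fun hcon => hi.not_gt hcon.2]
    simp

end POD

/-! ### Linearity of the Ritz projection -/

section Ritz

variable (V : Submodule ℝ (H10 d m Ω)) [FiniteDimensional ℝ V]

/-- The difference of two candidates lies in `V` and is orthogonal to itself. As `ritz` is obtained
by choice, its linearity is derived from this uniqueness. -/
theorem ritz_eq_of_mem (hinj : Function.Injective (grad : H10 d m Ω → GradL2 d m Ω))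
    {w p : H10 d m Ω} (hp : p ∈ V) (h : ∀ v ∈ V, innerH10 (w - p) v = 0) : ritz V w = p := by
  have h1 := innerH10_sub_ritz V w (ritz V w - p) (V.sub_mem (ritz_mem V w) hp)
  have h2 := h (ritz V w - p) (V.sub_mem (ritz_mem V w) hp)
  refine sub_eq_zero.1 ((map_eq_zero_iff grad hinj).1 ?_)
  rw [← inner_self_eq_zero (𝕜 := ℝ)]
  have : inner ℝ (grad (ritz V w - p)) (grad (ritz V w - p))
      = innerH10 (w - p) (ritz V w - p) - innerH10 (w - ritz V w) (ritz V w - p) := by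
    rw [innerH10, innerH10, ← inner_sub_left, ← map_sub, sub_sub_sub_cancel_left]
  rw [this, h1, h2, sub_zero]

/-- The error `w - R w` of the Ritz projection, as a linear map. -/
def ritzError (hinj : Function.Injective (grad : H10 d m Ω → GradL2 d m Ω)) :
    H10 d m Ω →ₗ[ℝ] H10 d m Ω where
  toFun w := w - ritz V w
  map_add' w w' := by
    have : ritz V (w + w') = ritz V w + ritz V w' :=
      ritz_eq_of_mem V hinj (V.add_mem (ritz_mem V w) (ritz_mem V w')) fun v hv => by
        rw [add_sub_add_comm, innerH10, map_add, inner_add_left]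
        have h1 := innerH10_sub_ritz V w v hv
        have h2 := innerH10_sub_ritz V w' v hv
        rw [innerH10] at h1 h2
        rw [h1, h2, add_zero]
    rw [this, add_sub_add_comm]
  map_smul' c w := by
    have : ritz V (c • w) = c • ritz V w :=
      ritz_eq_of_mem V hinj (V.smul_mem c (ritz_mem V w)) fun v hv => by
        have h1 := innerH10_sub_ritz V w v hv
        rw [innerH10] at h1
        rw [← smul_sub c w (ritz V w), innerH10, map_smul, real_inner_smul_left, h1, mul_zero]
    rw [this, ← smul_sub, RingHom.id_apply]

theorem ritzError_apply (hinj : Function.Injective (grad : H10 d m Ω → GradL2 d m Ω))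
    (w : H10 d m Ω) : ritzError V hinj w = w - ritz V w := rfl

theorem ritzError_eq_zero (hinj : Function.Injective (grad : H10 d m Ω → GradL2 d m Ω))
    {w : H10 d m Ω} (hw : w ∈ V) : ritzError V hinj w = 0 := by
  rw [ritzError_apply, ritz_eq_of_mem V hinj hw fun v _ => by simp [innerH10], sub_self]

end Ritz

/-- The Ritz projection annihilates the truncated modes of the `H¹₀` POD basis. -/
theorem IsPOD.ritz_podMode_eq_zero
    (hinj : Function.Injective (grad : H10 d m Ω → GradL2 d m Ω)) {M : ℕ} (hM : 0 < M)
    {v : Fin M → H10 d m Ω} {lam : Fin M → ℝ} {z : Fin M → EuclideanSpace ℝ (Fin M)}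
    (h : IsPOD innerH10 v lam z) {r : ℕ} {i : Fin M} (hi : i ∈ truncated lam r) :
    ritz (podSpace v lam z r) (podMode v lam z i) = 0 := by
  obtain ⟨hri, hs⟩ := (Finset.mem_filter.1 hi).2
  refine ritz_eq_of_mem _ hinj (Submodule.zero_mem _) fun w hw => ?_
  rw [sub_zero]
  refine Submodule.span_induction ?_ (by simp [innerH10]) ?_ ?_ hw
  · rintro _ ⟨l, hl, rfl⟩
    have := IsPOD.inner_podMode (J := grad) hM h ((pos_iff_lt_podRank h.antitone i).2 hs) l
    rwa [if_neg fun hil : i = l => hri.not_gt (hil ▸ hl)] at this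
  · intro x y _ _ hx hy
    rw [innerH10] at hx hy ⊢
    rw [map_add, inner_add_right, hx, hy, add_zero]
  · intro c x _ hx
    rw [innerH10] at hx ⊢
    rw [map_smul, real_inner_smul_right, hx, mul_zero]

/-! ### Discrete estimates -/

theorem norm_sub_le_two_sq {F : Type*} [SeminormedAddCommGroup F] (x y : F) :
    ‖x - y‖ ^ 2 ≤ 2 * ‖x‖ ^ 2 + 2 * ‖y‖ ^ 2 := by
  have := pow_le_pow_left₀ (norm_nonneg _) (norm_sub_le x y) 2
  nlinarith [sq_nonneg (‖x‖ - ‖y‖)]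

/-- One step of the energy estimate for the Crank-Nicolson scheme. The last term is the
consistency error of the scheme. -/
theorem crankNicolson_step (V : Submodule ℝ (H10 d m Ω)) [FiniteDimensional ℝ V] {h ν : ℝ}
    (hh : 0 < h) (hν : 0 < ν) {u₀ u₁ p₀ p₁ : H10 d m Ω} (hp₀ : p₀ ∈ V) (hp₁ : p₁ ∈ V)
    {y₀ y₁ f₀ f₁ : L2 d m Ω}
    (h₀ : ∀ v : H10 d m Ω,
      inner ℝ y₀ (toL2 v) + ν * inner ℝ (grad u₀) (grad v) = inner ℝ f₀ (toL2 v))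
    (h₁ : ∀ v : H10 d m Ω,
      inner ℝ y₁ (toL2 v) + ν * inner ℝ (grad u₁) (grad v) = inner ℝ f₁ (toL2 v))
    (hs : ∀ v ∈ V, innerL2 (h⁻¹ • (p₁ - p₀)) v + ν * innerH10 ((1 / 2 : ℝ) • (p₁ + p₀)) v
      = inner ℝ ((1 / 2 : ℝ) • (f₁ + f₀)) (toL2 v)) :
    ‖grad (p₁ - ritz V u₁)‖ ^ 2 ≤ ‖grad (p₀ - ritz V u₀)‖ ^ 2
      + h / ν * (‖toL2 (h⁻¹ • ((u₁ - ritz V u₁) - (u₀ - ritz V u₀)))‖ ^ 2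
        + ‖h⁻¹ • (toL2 u₁ - toL2 u₀) - (1 / 2 : ℝ) • (y₁ + y₀)‖ ^ 2) := by
  set φ₀ := p₀ - ritz V u₀ with hφ₀
  set φ₁ := p₁ - ritz V u₁ with hφ₁
  set ρ := toL2 (h⁻¹ • ((u₁ - ritz V u₁) - (u₀ - ritz V u₀))) with hρ
  set τ := h⁻¹ • (toL2 u₁ - toL2 u₀) - (1 / 2 : ℝ) • (y₁ + y₀) with hτ
  have hv : h⁻¹ • (φ₁ - φ₀) ∈ V := V.smul_mem _ (V.sub_mem
    (V.sub_mem hp₁ (ritz_mem V u₁)) (V.sub_mem hp₀ (ritz_mem V u₀)))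
  -- Error equation: the scheme minus the averaged weak forms, with `∇(u - R u)` removed by Ritz
  -- orthogonality. It is then tested with the difference quotient of `φ`.
  have hhom : ∀ v ∈ V, inner ℝ (h⁻¹ • (toL2 φ₁ - toL2 φ₀)) (toL2 v)
      + ν / 2 * inner ℝ (grad φ₁ + grad φ₀) (grad v) = inner ℝ (ρ - τ) (toL2 v) := by
    intro v hv
    have e1 := hs v hv
    have e2 := innerH10_sub_ritz V u₀ v hv
    have e3 := innerH10_sub_ritz V u₁ v hv
    have e4 := h₀ v
    have e5 := h₁ v
    simp only [innerL2, innerH10, hφ₀, hφ₁, hρ, hτ, map_add, map_sub, map_smul, inner_add_left,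
      inner_sub_left, real_inner_smul_left] at e1 e2 e3 e4 e5 ⊢
    linear_combination e1 + ν / 2 * e2 + ν / 2 * e3 - (1 / 2) * e4 - (1 / 2) * e5
  have hkey := hhom _ hv
  have hδ : toL2 (h⁻¹ • (φ₁ - φ₀)) = h⁻¹ • (toL2 φ₁ - toL2 φ₀) := by rw [map_smul, map_sub]
  have hg : grad (h⁻¹ • (φ₁ - φ₀)) = h⁻¹ • (grad φ₁ - grad φ₀) := by rw [map_smul, map_sub]
  have hsq : inner ℝ (grad φ₁ + grad φ₀) (grad φ₁ - grad φ₀)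
      = ‖grad φ₁‖ ^ 2 - ‖grad φ₀‖ ^ 2 := by
    rw [inner_add_left, inner_sub_right, inner_sub_right, real_inner_self_eq_norm_sq,
      real_inner_self_eq_norm_sq, real_inner_comm (grad φ₁)]
    ring
  rw [hδ, hg, real_inner_self_eq_norm_sq, real_inner_smul_right, hsq] at hkey
  set δ := h⁻¹ • (toL2 φ₁ - toL2 φ₀)
  have h1 := real_inner_le_norm (ρ - τ) δ
  have h2 := norm_sub_le_two_sq ρ τ
  -- Young: `⟪ρ - τ, δ⟫ ≤ ‖δ‖² + ‖ρ - τ‖² / 4`, and `‖δ‖²` cancels against the left side.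
  have h3 : ν / 2 * (h⁻¹ * (‖grad φ₁‖ ^ 2 - ‖grad φ₀‖ ^ 2)) ≤ 1 / 2 * (‖ρ‖ ^ 2 + ‖τ‖ ^ 2) := by
    nlinarith [sq_nonneg (‖δ‖ - ‖ρ - τ‖ / 2)]
  have h4 : ‖grad φ₁‖ ^ 2 - ‖grad φ₀‖ ^ 2
      = 2 * h / ν * (ν / 2 * (h⁻¹ * (‖grad φ₁‖ ^ 2 - ‖grad φ₀‖ ^ 2))) := by
    field_simp
  have h5 := mul_le_mul_of_nonneg_left h3 (show 0 ≤ 2 * h / ν by positivity)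
  rw [← h4] at h5
  have h6 : 2 * h / ν * (1 / 2 * (‖ρ‖ ^ 2 + ‖τ‖ ^ 2)) = h / ν * (‖ρ‖ ^ 2 + ‖τ‖ ^ 2) := by ring
  linarith

/-- A discrete Sobolev inequality in time. -/
theorem norm_sq_le_sum_difference {F : Type*} [SeminormedAddCommGroup F] [NormedSpace ℝ F]
    (a : ℕ → F) {N k : ℕ} (hk : k ≤ N) {h : ℝ} (hh : 0 < h) :
    ((N : ℝ) + 1) * ‖a k‖ ^ 2 ≤ 2 * ∑ j ∈ Finset.range (N + 1), ‖a j‖ ^ 2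
      + 2 * (N + 1) * (h ^ 2 * N * ∑ n ∈ Finset.range N, ‖h⁻¹ • (a (n + 1) - a n)‖ ^ 2) := by
  set D := ∑ n ∈ Finset.range N, ‖h⁻¹ • (a (n + 1) - a n)‖ ^ 2
  have hmono : ∀ i j, i ≤ j → j ≤ N →
      dist (a i) (a j) ≤ ∑ n ∈ Finset.range N, ‖a (n + 1) - a n‖ := by
    intro i j hij hj
    refine (dist_le_Ico_sum_dist a hij).trans ?_
    simp only [dist_eq_norm, norm_sub_rev (a _) (a (_ + 1))]
    refine Finset.sum_le_sum_of_subset_of_nonneg (fun n hn => ?_) fun _ _ _ => norm_nonneg _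
    exact Finset.mem_range.2 ((Finset.mem_Ico.1 hn).2.trans_le hj)
  -- Any two values differ by at most the total variation, and Cauchy-Schwarz costs the factor `N`.
  -- Summing over all `j` then compares `a k` with the mean square.
  have hdist : ∀ j ≤ N, ‖a k - a j‖ ^ 2 ≤ h ^ 2 * N * D := by
    intro j hj
    have h1 : ‖a k - a j‖ ≤ ∑ n ∈ Finset.range N, ‖a (n + 1) - a n‖ := by
      rw [← dist_eq_norm]
      rcases le_total j k with hjk | hjk
      · rw [dist_comm]
        exact hmono j k hjk hk
      · exact hmono k j hjk hj
    have h2 := sq_sum_le_card_mul_sum_sq (s := Finset.range N) (f := fun n => ‖a (n + 1) - a n‖)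
    have h3 : h ^ 2 * D = ∑ n ∈ Finset.range N, ‖a (n + 1) - a n‖ ^ 2 := by
      rw [Finset.mul_sum]
      refine Finset.sum_congr rfl fun n _ => ?_
      rw [norm_smul, norm_inv, Real.norm_of_nonneg hh.le]
      field_simp
    rw [Finset.card_range, ← h3] at h2
    calc _ ≤ _ := pow_le_pow_left₀ (norm_nonneg _) h1 2
      _ ≤ _ := h2
      _ = _ := by ring
  have hj : ∀ j ∈ Finset.range (N + 1), ‖a k‖ ^ 2 ≤ 2 * ‖a j‖ ^ 2 + 2 * (h ^ 2 * N * D) := by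
    intro j hj
    have h1 := hdist j (Nat.lt_succ_iff.1 (Finset.mem_range.1 hj))
    have h2 := norm_sub_le_two_sq (a k - a j) (-a j)
    rw [sub_neg_eq_add, sub_add_cancel, norm_neg] at h2
    linarith
  have := Finset.sum_le_sum hj
  rw [Finset.sum_const, Finset.card_range, nsmul_eq_mul, Finset.sum_add_distrib, ← Finset.mul_sum,
    Finset.sum_const, Finset.card_range, nsmul_eq_mul] at this
  push_cast at this
  linarith

theorem sum_dqSnapshots {E : Type*} [AddCommGroup E] [Module ℝ E] (T : ℝ) (N : ℕ) (u : ℝ → E)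
    (g : E → ℝ) :
    ∑ j, g (dqSnapshots T N u j) = ∑ n ∈ Finset.range (N + 1), g (u (time T N n))
      + ∑ n ∈ Finset.range N, g ((T / N)⁻¹ • (u (time T N (n + 1)) - u (time T N n))) := by
  have h := Fin.sum_univ_eq_sum_range (fun j => g (if j ≤ N then u (time T N j)
    else (T / N)⁻¹ • (u (time T N (j - N)) - u (time T N (j - N - 1))))) (2 * N + 1)
  simp only [dqSnapshots]
  rw [h, show 2 * N + 1 = (N + 1) + N by ring, Finset.sum_range_add]
  congr 1
  · refine Finset.sum_congr rfl fun n hn => ?_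
    rw [if_pos (Nat.lt_succ_iff.1 (Finset.mem_range.1 hn))]
  -- Snapshot `N + 1 + n` is the difference quotient over `[t_n, t_{n+1}]`.
  · refine Finset.sum_congr rfl fun n _ => ?_
    rw [if_neg (by omega), show N + 1 + n - N = n + 1 by omega, Nat.add_sub_cancel]

theorem time_succ (T : ℝ) (N n : ℕ) : time T N (n + 1) - time T N n = T / N := by
  simp only [time]
  push_cast
  ring

theorem time_zero (T : ℝ) (N : ℕ) : time T N 0 = 0 := by simp [time]

theorem time_self (T : ℝ) {N : ℕ} (hN : 0 < N) : time T N N = T := by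
  have : (N : ℝ) ≠ 0 := by positivity
  simp only [time]
  field_simp

theorem time_mem_Icc {T : ℝ} (hT : 0 < T) {N n : ℕ} (hN : 0 < N) (hn : n ≤ N) :
    time T N n ∈ Icc 0 T := by
  have hh : 0 ≤ T / N := by positivity
  refine ⟨mul_nonneg n.cast_nonneg hh, ?_⟩
  calc time T N n ≤ time T N N := mul_le_mul_of_nonneg_right (by exact_mod_cast hn) hh
    _ = T := time_self T hN

/-- Energy estimate for the reduced order model, compared with the Ritz projection. -/
theorem norm_grad_sub_ritz_le (hΩ : IsOpen Ω) {ν T : ℝ} (hν : 0 < ν) (hT : 0 < T)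
    {u : ℝ → H10 d m Ω} {f uttt Δutt ftt : ℝ → L2 d m Ω} (hu : IsHeatSolution ν T u f)
    (hr : HasRegularity T u f uttt Δutt ftt) {N : ℕ} (hN : 0 < N)
    (V : Submodule ℝ (H10 d m Ω)) [FiniteDimensional ℝ V] {ur : ℕ → H10 d m Ω}
    (hur : IsCrankNicolson ν T N f V ur) {k : ℕ} (hk : k ≤ N) :
    ‖grad (ur k - ritz V (u (time T N k)))‖ ^ 2 ≤ ‖grad (ur 0 - ritz V (u 0))‖ ^ 2
      + T / N / ν * ∑ n ∈ Finset.range N, ‖toL2 ((T / N : ℝ)⁻¹ •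
          ((u (time T N (n + 1)) - ritz V (u (time T N (n + 1))))
            - (u (time T N n) - ritz V (u (time T N n)))))‖ ^ 2
      + 9 / 4 / ν * (T / N) ^ 4 * sqNormL2Time T uttt := by
  obtain ⟨y, hy, hτ⟩ := exists_velocity hΩ hν hT hu hr
  have hh : 0 < T / N := by positivity
  set h := T / (N : ℝ)
  set ρ : ℕ → ℝ := fun n => ‖toL2 (h⁻¹ •
    ((u (time T N (n + 1)) - ritz V (u (time T N (n + 1))))
      - (u (time T N n) - ritz V (u (time T N n)))))‖ ^ 2
  set I : ℕ → ℝ := fun n => ∫ t in time T N n..time T N (n + 1), ‖uttt t‖ ^ 2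
  have hlt : ∀ n, time T N n < time T N (n + 1) := fun n => by
    have := time_succ T N n
    linarith
  have hI : ∀ n, 0 ≤ I n := fun n => intervalIntegral.integral_nonneg (hlt n).le fun t _ => by
    positivity
  have hstep : ∀ n < N, ‖grad (ur (n + 1) - ritz V (u (time T N (n + 1))))‖ ^ 2
      ≤ ‖grad (ur n - ritz V (u (time T N n)))‖ ^ 2
        + h / ν * (ρ n + 9 / 4 * h ^ 3 * I n) := by
    intro n hn
    have ht0 := time_mem_Icc hT hN hn.le
    have ht1 := time_mem_Icc hT hN (Nat.succ_le_of_lt hn)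
    refine (crankNicolson_step V hh hν (hur.mem n hn.le) (hur.mem (n + 1) hn) (hy _ ht0)
      (hy _ ht1) (hur.scheme n hn)).trans ?_
    have := hτ _ _ ht0.1 (hlt n) ht1.2
    rw [time_succ] at this
    gcongr
  have hind : ∀ k ≤ N, ‖grad (ur k - ritz V (u (time T N k)))‖ ^ 2
      ≤ ‖grad (ur 0 - ritz V (u 0))‖ ^ 2
        + h / ν * ∑ n ∈ Finset.range k, (ρ n + 9 / 4 * h ^ 3 * I n) := by
    intro k
    induction k with
    | zero => intro _; simp [time_zero]
    | succ k ih =>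
      intro hk
      rw [Finset.sum_range_succ, mul_add]
      linarith [ih (Nat.le_of_succ_le hk), hstep k hk]
  have hmono : ∑ n ∈ Finset.range k, (ρ n + 9 / 4 * h ^ 3 * I n)
      ≤ ∑ n ∈ Finset.range N, (ρ n + 9 / 4 * h ^ 3 * I n) :=
    Finset.sum_le_sum_of_subset_of_nonneg (Finset.range_mono hk) fun n _ _ => by
      have := hI n
      positivity
  have hsum : ∑ n ∈ Finset.range N, I n = sqNormL2Time T uttt := by
    have hint : IntegrableOn (fun t => ‖uttt t‖ ^ 2) (Ioo 0 T) :=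
      MemLp.integrable_norm_pow hr.memL2_uttt two_ne_zero
    rw [intervalIntegral.sum_integral_adjacent_intervals fun n hn => ?_, time_zero,
      time_self T hN, intervalIntegral.integral_of_le hT.le, integral_Ioc_eq_integral_Ioo]
    · rfl
    · rw [intervalIntegrable_iff_integrableOn_Ioo_of_le (hlt n).le]
      exact hint.mono_set (Ioo_subset_Ioo (time_mem_Icc hT hN hn.le).1
        (time_mem_Icc hT hN (Nat.succ_le_of_lt hn)).2)
  refine (hind k hk).trans ((add_le_add_right (mul_le_mul_of_nonneg_left hmono
    (by positivity)) _).trans (le_of_eq ?_))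
  rw [Finset.sum_add_distrib, ← Finset.mul_sum, hsum]
  ring

/-! ### The error estimate -/

/-- Here `S` and `D` are the parts of the snapshot sum from nodal values and difference quotients,
and `P` is the truncated POD sum. The factor `2N + 1` is harmless: `h * (2N + 1) = 2T + h ≤ 3T`. -/
theorem step_mul_le_of_add_eq {T N h S D P : ℝ} (hN : 1 ≤ N) (hh : 0 < h) (hhN : h * N = T)
    (hS : 0 ≤ S) (hP : 0 ≤ P) (h1 : S + D = (2 * N + 1) * P) : h * D ≤ 3 * T * P := by
  have h2 : h * D ≤ h * ((2 * N + 1) * P) := mul_le_mul_of_nonneg_left (by linarith) hh.le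
  have h3 : h * ((2 * N + 1) * P) = (2 * (h * N) + h) * P := by ring
  rw [h3, hhN] at h2
  exact h2.trans (mul_le_mul_of_nonneg_right (by nlinarith) hP)

/-- Dividing by `N + 1`: `2S ≤ 4(N + 1)P` gives `4`, and `h² N D = T (h D) ≤ 3T² P` gives `6T²`. -/
theorem le_of_difference_bound {T N h S D P η : ℝ} (hN : 1 ≤ N) (hh : 0 < h) (hhN : h * N = T)
    (hS : 0 ≤ S) (hD : 0 ≤ D) (hP : 0 ≤ P) (h1 : S + D = (2 * N + 1) * P)
    (h2 : (N + 1) * η ≤ 2 * S + 2 * (N + 1) * (h ^ 2 * N * D)) : η ≤ (4 + 6 * T ^ 2) * P := by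
  have hT : 0 ≤ T := hhN ▸ by positivity
  have h3 := mul_le_mul_of_nonneg_left (step_mul_le_of_add_eq hN hh hhN hS hP h1) hT
  have h4 : h ^ 2 * N * D = T * (h * D) := by rw [← hhN]; ring
  rw [h4] at h2
  have h5 := mul_le_mul_of_nonneg_left h3 (show 0 ≤ N + 1 by linarith)
  refine le_of_mul_le_mul_left (a := N + 1) ?_ (by linarith)
  linarith

/-- The constant is the sum of the coefficients `6T/ν` of `PL`, `8 + 12T²` of `PG`, `2` of `P0` and
`9/(2ν)` of `B`. -/
theorem error_le_of_bounds {T ν D PL PG P0 B b h E X Y : ℝ} (hT : 0 < T) (hν : 0 < ν)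
    (hPL : 0 ≤ PL) (hPG : 0 ≤ PG) (hP0 : 0 ≤ P0) (hB : 0 ≤ B) (hD : h * D ≤ 3 * T * PL)
    (hb : b ≤ B) (hX : X ≤ (4 + 6 * T ^ 2) * PG) (hY : Y ≤ P0 + h / ν * D + 9 / 4 / ν * b)
    (hE : E ≤ 2 * X + 2 * Y) :
    E ≤ (10 + 12 * T ^ 2 + 6 * T / ν + 9 / 2 / ν) * (PL + PG + P0 + B) := by
  have h1 : h / ν * D ≤ 3 * T * PL * (1 / ν) := by
    calc h / ν * D = h * D * (1 / ν) := by ring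
      _ ≤ _ := mul_le_mul_of_nonneg_right hD (by positivity)
  have h2 : 9 / 4 / ν * b ≤ 9 / 4 / ν * B := by gcongr
  have h3 : E ≤ 2 * ((4 + 6 * T ^ 2) * PG) + 2 * (P0 + 3 * T * PL * (1 / ν) + 9 / 4 / ν * B) := by
    linarith
  refine h3.trans (sub_nonneg.1 ?_)
  have h4 : (10 + 12 * T ^ 2 + 6 * T / ν + 9 / 2 / ν) * (PL + PG + P0 + B)
      - (2 * ((4 + 6 * T ^ 2) * PG) + 2 * (P0 + 3 * T * PL * (1 / ν) + 9 / 4 / ν * B))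
      = (10 + 12 * T ^ 2 + 9 / 2 / ν) * PL + (2 + 6 * T / ν + 9 / 2 / ν) * PG
        + (8 + 12 * T ^ 2 + 6 * T / ν + 9 / 2 / ν) * P0 + (10 + 12 * T ^ 2 + 6 * T / ν) * B := by
    ring
  rw [h4]
  positivity

/-- Common core of both claims: the POD inner product enters only through an injective `J`, while
the projection error may be measured in any norm. -/
theorem norm_grad_error_le (hd : 0 < d) (hΩ : IsOpen Ω) (hΩb : Bornology.IsBounded Ω)
    {ν T : ℝ} (hν : 0 < ν) (hT : 0 < T)
    {u : ℝ → H10 d m Ω} {f uttt Δutt ftt : ℝ → L2 d m Ω} (hu : IsHeatSolution ν T u f)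
    (hr : HasRegularity T u f uttt Δutt ftt) {N : ℕ} (hN : 0 < N)
    {lam : Fin (2 * N + 1) → ℝ} {z : Fin (2 * N + 1) → EuclideanSpace ℝ (Fin (2 * N + 1))}
    {r : ℕ} {ur : ℕ → H10 d m Ω}
    (hur : IsCrankNicolson ν T N f (podSpace (dqSnapshots T N u) lam z r) ur)
    {G : Type*} [NormedAddCommGroup G] [InnerProductSpace ℝ G] {J : H10 d m Ω →ₗ[ℝ] G}
    (hJ : Function.Injective J)
    (hpod : IsPOD (fun a b => inner ℝ (J a) (J b)) (dqSnapshots T N u) lam z)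
    {k : ℕ} (hk : k ≤ N) :
    ‖grad (u (time T N k) - ur k)‖ ^ 2 ≤ (10 + 12 * T ^ 2 + 6 * T / ν + 9 / 2 / ν) *
      (∑ i ∈ truncated lam r, lam i *
        (‖toL2 (podMode (dqSnapshots T N u) lam z i
            - ritz (podSpace (dqSnapshots T N u) lam z r) (podMode (dqSnapshots T N u) lam z i))‖ ^ 2
          + ‖grad (podMode (dqSnapshots T N u) lam z i
            - ritz (podSpace (dqSnapshots T N u) lam z r)
                (podMode (dqSnapshots T N u) lam z i))‖ ^ 2)
        + ‖grad (ur 0 - ritz (podSpace (dqSnapshots T N u) lam z r) (u 0))‖ ^ 2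
        + (T / N) ^ 4 * regConst T uttt Δutt ftt) := by
  have hinj := grad_injective (m := m) hd hΩ hΩb
  set V := podSpace (dqSnapshots T N u) lam z r
  set A := ritzError V hinj
  set h := T / (N : ℝ) with hh_def
  have hN' : (1 : ℝ) ≤ N := by exact_mod_cast hN
  have hh : 0 < h := by positivity
  set PL := ∑ i ∈ truncated lam r, lam i * ‖toL2 (A (podMode (dqSnapshots T N u) lam z i))‖ ^ 2
  set PG := ∑ i ∈ truncated lam r, lam i * ‖grad (A (podMode (dqSnapshots T N u) lam z i))‖ ^ 2
  have hL := hpod.sum_norm_sq_eq hJ (Nat.succ_pos _) (toL2 ∘ₗ A) (r := r) fun x hx => by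
    simp [A, ritzError_eq_zero V hinj hx]
  have hG := hpod.sum_norm_sq_eq hJ (Nat.succ_pos _) (grad ∘ₗ A) (r := r) fun x hx => by
    simp [A, ritzError_eq_zero V hinj hx]
  simp only [LinearMap.comp_apply] at hL hG
  rw [sum_dqSnapshots T N u fun x => ‖toL2 (A x)‖ ^ 2] at hL
  rw [sum_dqSnapshots T N u fun x => ‖grad (A x)‖ ^ 2] at hG
  simp only [map_smul, map_sub] at hL hG
  change _ = _ * PL at hL
  change _ = _ * PG at hG
  push_cast at hL hG
  have hφ := norm_grad_sub_ritz_le hΩ hν hT hu hr hN V hur hk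
  have hη := norm_sq_le_sum_difference (fun n => grad (A (u (time T N n)))) hk hh
  have hρ : ∀ n, toL2 ((T / (N : ℝ))⁻¹ • ((u (time T N (n + 1)) - ritz V (u (time T N (n + 1))))
      - (u (time T N n) - ritz V (u (time T N n)))))
      = h⁻¹ • (toL2 (A (u (time T N (n + 1)))) - toL2 (A (u (time T N n)))) := fun n => by
    rw [map_smul, map_sub, ← ritzError_apply V hinj, ← ritzError_apply V hinj]
  simp only [hρ] at hφ
  have hsq : ∀ g : ℝ → L2 d m Ω, 0 ≤ sqNormL2Time T g := fun g =>
    integral_nonneg fun t => sq_nonneg _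
  have hB : h ^ 4 * sqNormL2Time T uttt ≤ h ^ 4 * regConst T uttt Δutt ftt := by
    refine mul_le_mul_of_nonneg_left ?_ (by positivity)
    rw [regConst, add_assoc]
    exact le_add_of_nonneg_right (add_nonneg (hsq Δutt) (hsq ftt))
  have hB0 := le_trans (mul_nonneg (by positivity) (hsq uttt)) hB
  have hhN : h * N = T := by rw [hh_def]; field_simp
  have hM : (0 : ℝ) < 2 * N + 1 := by positivity
  have hnn : ∀ {F : Type _} [NormedAddCommGroup F] (s : Finset ℕ) (g : ℕ → F),
      0 ≤ ∑ n ∈ s, ‖g n‖ ^ 2 := fun s g => Finset.sum_nonneg fun n _ => sq_nonneg _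
  have hPL0 : 0 ≤ PL := nonneg_of_mul_nonneg_right (hL ▸ add_nonneg (hnn _ _) (hnn _ _)) hM
  have hPG0 : 0 ≤ PG := nonneg_of_mul_nonneg_right (hG ▸ add_nonneg (hnn _ _) (hnn _ _)) hM
  -- The splitting of the error into `η` and `φ`.
  have hsplit : grad (u (time T N k) - ur k)
      = grad (A (u (time T N k))) - grad (ur k - ritz V (u (time T N k))) := by
    rw [← map_sub, ritzError_apply, sub_sub_sub_cancel_right]
  have hfin := norm_sub_le_two_sq (grad (A (u (time T N k))))
    (grad (ur k - ritz V (u (time T N k))))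
  rw [← hsplit] at hfin
  have hsum : ∑ i ∈ truncated lam r, lam i *
        (‖toL2 (podMode (dqSnapshots T N u) lam z i
            - ritz V (podMode (dqSnapshots T N u) lam z i))‖ ^ 2
          + ‖grad (podMode (dqSnapshots T N u) lam z i
            - ritz V (podMode (dqSnapshots T N u) lam z i))‖ ^ 2) = PL + PG := by
    rw [← Finset.sum_add_distrib]
    exact Finset.sum_congr rfl fun i _ => mul_add _ _ _
  rw [hsum]
  rw [mul_assoc] at hφ
  exact error_le_of_bounds hT hν hPL0 hPG0 (sq_nonneg _) hB0
    (step_mul_le_of_add_eq hN' hh hhN (hnn _ _) hPL0 hL) hB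
    (le_of_difference_bound hN' hh hhN (hnn _ _) (hnn _ _) hPG0 hG hη) hφ hfin

end HeatROM

end

theorem mainTheorem4 (d m : ℕ) (hd : 0 < d) (Ω : Set (EuclideanSpace ℝ (Fin d)))
    (hΩ : IsOpen Ω) (hΩb : Bornology.IsBounded Ω) (ν T : ℝ) (hν : 0 < ν) (hT : 0 < T) :
    ∃ C : ℝ, 0 < C ∧
      ∀ (u : ℝ → H10 d m Ω) (f uttt Δutt ftt : ℝ → L2 d m Ω),
        IsHeatSolution ν T u f → HasRegularity T u f uttt Δutt ftt →
      ∀ N : ℕ, 0 < N →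
      ∀ (lam : Fin (2 * N + 1) → ℝ) (z : Fin (2 * N + 1) → EuclideanSpace ℝ (Fin (2 * N + 1))),
      ∀ r ≤ podRank lam, ∀ ur : ℕ → H10 d m Ω,
        IsCrankNicolson ν T N f (podSpace (dqSnapshots T N u) lam z r) ur →
        (IsPOD innerL2 (dqSnapshots T N u) lam z →
          ∀ k : ℕ, 1 ≤ k → k ≤ N →
            ‖grad (u (time T N k) - ur k)‖ ^ 2 ≤
              C * (∑ i ∈ truncated lam r, lam i *
                    (‖toL2 (podMode (dqSnapshots T N u) lam z i
                        - ritz (podSpace (dqSnapshots T N u) lam z r)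
                            (podMode (dqSnapshots T N u) lam z i))‖ ^ 2
                      + ‖grad (podMode (dqSnapshots T N u) lam z i
                        - ritz (podSpace (dqSnapshots T N u) lam z r)
                            (podMode (dqSnapshots T N u) lam z i))‖ ^ 2)
                + ‖grad (ur 0 - ritz (podSpace (dqSnapshots T N u) lam z r) (u 0))‖ ^ 2
                + (T / N) ^ 4 * regConst T uttt Δutt ftt)) ∧
        (IsPOD innerH10 (dqSnapshots T N u) lam z →
          ∀ k : ℕ, 1 ≤ k → k ≤ N →
            ‖grad (u (time T N k) - ur k)‖ ^ 2 ≤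
              C * (∑ i ∈ truncated lam r, lam i *
                    (1 + ‖toL2 (podMode (dqSnapshots T N u) lam z i)‖ ^ 2)
                + ‖grad (ur 0 - ritz (podSpace (dqSnapshots T N u) lam z r) (u 0))‖ ^ 2
                + (T / N) ^ 4 * regConst T uttt Δutt ftt)) := by
  have hinj := grad_injective (m := m) hd hΩ hΩb
  refine ⟨10 + 12 * T ^ 2 + 6 * T / ν + 9 / 2 / ν, by positivity, ?_⟩
  intro u f uttt Δutt ftt hu hr N hN lam z r _ ur hur
  refine ⟨fun hpod k _ hk => norm_grad_error_le hd hΩ hΩb hν hT hu hr hN hur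
    (toL2_injective hΩ) hpod hk, fun hpod k _ hk => ?_⟩
  -- With `J = grad` the truncated modes have zero Ritz projection and unit gradient norm, so the
  -- two sums agree term by term.
  refine (norm_grad_error_le hd hΩ hΩb hν hT hu hr hN hur hinj hpod hk).trans (le_of_eq ?_)
  congr 3
  refine Finset.sum_congr rfl fun i hi => ?_
  rw [hpod.ritz_podMode_eq_zero hinj (Nat.succ_pos _) hi, sub_zero]
  have h1 := IsPOD.inner_podMode (J := grad) (Nat.succ_pos _) hpod
    ((pos_iff_lt_podRank hpod.antitone i).2 (Finset.mem_filter.1 hi).2.2) i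
  rw [if_pos rfl, real_inner_self_eq_norm_sq] at h1
  rw [h1, add_comm]
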